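/- **Setting.** Quantum variables have type Boolean (space $\mathbb C^2$, basis $|0\rangle,|1\rangle$) or integer (space $\ell^2(\mathbb Z)$, basis $|n\rangle$, $n\in\mathbb Z$), with infinitely many names of each type. For a finite set $X$ of variables $\mathcal H_X=\bigotimes_{q\in X}\mathcal H_q$; a partial density operator on $\mathcal H_X$ is a positive operator $\rho$ with $\operatorname{tr}\rho\le 1$. Operators on some of the variables act on $\mathcal H_X$ after tensoring with the identity. **Programs.** A declaration $D$ consists of mutually recursive procedures $\mathrm{proc}_i(\bar y_i)\Leftarrow S_i$, $1\le i\le n$ (parameter lists may be empty, bodies may use global variables). Statements are $$S::=\bot\mid \mathbf{skip}\mid q:=|0\rangle\mid \bar q*{=}U\mid S_1;S_2\mid \mathbf{if}\,(\Box m\cdot M[\bar q]=m\to S_m)\,\mathbf{fi}\mid \mathbf{local}\ \bar q;S;\mathbf{release}\ \bar q\mid \mathbf{call}\ \mathrm{proc}_i(\bar p),$$ with $U$ unitary, $M=\{M_m\}$ a countable family of bounded operators with $\sum_m M_m^\dagger M_m=I$, and $\bar p$ matching $\bar y_i$ in length and types. Local variables and formal parameters are bound; statements are identified up to renaming of bound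 variables and substitution is capture-avoiding. Programs without parameters and local variables are the basic recursive programs. **Operational semantics.** One-step transitions between configurations $\langle S,\rho\rangle$ ($E$ is the empty program, labels are $\epsilon$ or outcomes $m$): $\langle\bot,\rho\rangle\xrightarrow{\epsilon}\langle E,0\rangle$; $\langle\mathbf{skip},\rho\rangle\xrightarrow{\epsilon}\langle E,\rho\rangle$; $\langle q:=|0\rangle,\rho\rangle\xrightarrow{\epsilon}\langle E,\sum_i|0\rangle_q\langle i|\rho|i\rangle_q\langle 0|\rangle$; $\langle\bar q*{=}U,\rho\rangle\xrightarrow{\epsilon}\langle E,U\rho U^\dagger\rangle$; $\langle\mathbf{if}\ldots\mathbf{fi},\rho\rangle\xrightarrow{m}\langle S_m,M_m\rho M_m^\dagger\rangle$; $\langle\mathbf{local}\ \bar q;S;\mathbf{release}\ \bar q,\rho\rangle\xrightarrow{\epsilon}\langle S[\bar r/\bar q];\mathbf{release}\ \bar r,\ \rho\otimes|0\rangle_{\bar r}\langle 0|\rangle$ for any distinct variables $\bar r$ of the types of $\bar q$ that do not occur in the state; $\langle\mathbf{release}\ \bar r,\rho\rangle\xrightarrow{\epsilon}\langle E,\operatorname{tr}_{\bar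 r}\rho\rangle$; $\langle\mathbf{call}\ \mathrm{proc}_i(\bar p),\rho\rangle\xrightarrow{\epsilon}\langle S_i[\bar p/\bar y_i],\rho\rangle$; and $S_1;S_2$ executes $S_1$ and continues with $S_2$ when $S_1$ has become $E$. Initialization, unitaries and measurements require the variables they act on to be distinct and present in the state; otherwise, and in all remaining cases, the execution fails. For a nonempty sequence $\alpha$ of labels, $\xrightarrow{\alpha}$ is the corresponding composition of one-step transitions. **Denotational semantics.** $[\![S]\!]$ maps states to states: $[\![\bot]\!]\rho=0$; $[\![\mathbf{skip}]\!]\rho=\rho$; $[\![q:=|0\rangle]\!]\rho=\sum_i|0\rangle_q\langle i|\rho|i\rangle_q\langle0|$; $[\![\bar q*{=}U]\!]\rho=U\rho U^\dagger$; $[\![S_1;S_2]\!]=[\![S_2]\!]\circ[\![S_1]\!]$; $[\![\mathbf{if}\ldots\mathbf{fi}]\!]\rho=\sum_m[\![S_m]\!](M_m\rho M_m^\dagger)$; $[\![\mathbf{local}\ \bar q;S;\mathbf{release}\ \bar q]\!]\rho=\operatorname{tr}_{\bar r}\big([\![S[\bar r/\bar q]]\!](\rho\otimes|0\rangle_{\bar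 r}\langle0|)\big)$ with fresh $\bar r$; and $$[\![\mathbf{call}\ \mathrm{proc}_i(\bar a)]\!]\rho=\bigsqcup_{k\ge0}[\![S_i^{(k)}[\bar a/\bar y_i]]\!]\rho$$ (least upper bound in the Löwner order), where $S_i^{(0)}=\bot$ and $S_i^{(k+1)}$ is $S_i$ with every call $\mathbf{call}\ \mathrm{proc}_j(\bar p)$ replaced by $\mathbf{skip};S_j^{(k)}[\bar p/\bar y_j]$. Operations whose variables are not distinct or not present in the state denote $0$. **Theorem.** Let $X$ be a finite set of variables that contains all global variables of $D$, and let $\rho$ be a partial density operator on $\mathcal H_X$. Then the least upper bound defining $[\![\mathbf{call}\ \mathrm{proc}_i(\bar a)]\!]\rho$ exists for all $i$ and all $\bar a$ in $X$. Moreover, let $S$ be a statement over $D$ whose free variables all lie in $X$. Then for every label sequence $\alpha$ there is at most one $\rho'$ with $\langle S,\rho\rangle\xrightarrow{\alpha}\langle E,\rho'\rangle$, this $\rho'$ is an operator on $\mathcal H_X$, and $$[\![S]\!](\rho)=\sum_{\alpha,\ \rho'\,:\,\langle S,\rho\rangle\xrightarrow{\alpha}\langle E,\rho'\rangle}\rho',$$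 where the sum has one term for every $\alpha$ for which such a $\rho'$ exists, and converges unconditionally in operator norm. -/

import Mathlib

noncomputable section

namespace RQP

open Classical

/-! ### Quantum variables, states and operators -/

/-- Types of quantum variables: qubits and quantum integers. -/
inductive QType where
  | bool
  | int

/-- Labels of the computational basis of a variable of a given type. -/
def Val : QType → Type
  | .bool => Bool
  | .int => ℤ

/-- The label of the default basis vector `|0⟩`. -/
def Val.zero : (t : QType) → Val t
  | .bool => false
  | .int => (0 : ℤ)

/-- The Hilbert space with orthonormal basis `K`. -/
abbrev Ell2 (K : Type) : Type := lp (fun _ : K => ℂ) 2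

/-- Bounded operators on the space with orthonormal basis `K`. -/
abbrev EllOp (K : Type) : Type := Ell2 K →L[ℂ] Ell2 K

/-- The computational basis vector `|k⟩`. -/
def ket {K : Type} (k : K) : Ell2 K := lp.single 2 k 1

/-- A partial density operator: a positive trace-class operator of trace at most one. -/
def IsPDOP {K : Type} (ρ : EllOp K) : Prop :=
  ρ.IsPositive ∧ ∃ c : ℝ, c ≤ 1 ∧ HasSum (fun k => (inner ℂ (ket k) (ρ (ket k))).re) c

/-- The operator `A ρ A†`, that is, the map `A ⋄ A†` applied to `ρ`. -/
def sandwich {J K : Type} (A : Ell2 J →L[ℂ] Ell2 K) (ρ : EllOp J) : EllOp K :=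
  A ∘L ρ ∘L (ContinuousLinearMap.adjoint A)

theorem memlp_two_iff {K : Type} {f : K → ℂ} :
    Memℓp f 2 ↔ Summable fun k => ‖f k‖ ^ 2 := by
  rw [memℓp_gen_iff (by norm_num)]
  simp

theorem ell2_hasSum {K : Type} (f : Ell2 K) : HasSum (fun k => ‖f k‖ ^ 2) (‖f‖ ^ 2) := by
  have := lp.hasSum_norm (p := 2) (by norm_num) f
  simpa using this

/-- A square-summable function as a vector. -/
def mkVec {K : Type} (f : K → ℂ) (hf : Summable fun k => ‖f k‖ ^ 2) : Ell2 K :=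
  ⟨f, memlp_two_iff.2 hf⟩

theorem mkVec_apply {K : Type} (f : K → ℂ) (hf : Summable fun k => ‖f k‖ ^ 2) (k : K) :
    mkVec f hf k = f k := rfl

/-- Restriction of coordinates along an injective map of bases, as a linear map. -/
def comapLin {J K : Type} (j : J → K) (hj : Function.Injective j) : Ell2 K →ₗ[ℂ] Ell2 J where
  toFun f := mkVec (fun a => f (j a)) ((ell2_hasSum f).summable.comp_injective hj)
  map_add' f g := by
    ext a
    simp only [mkVec_apply, lp.coeFn_add, Pi.add_apply]
  map_smul' c f := by
    ext a
    simp only [mkVec_apply, lp.coeFn_smul, Pi.smul_apply, RingHom.id_apply]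

theorem comapLin_bound {J K : Type} (j : J → K) (hj : Function.Injective j) (f : Ell2 K) :
    ‖comapLin j hj f‖ ≤ 1 * ‖f‖ := by
  rw [one_mul]
  refine (pow_le_pow_iff_left₀ (norm_nonneg _) (norm_nonneg _) two_ne_zero).1 ?_
  have h1 : HasSum (fun a => ‖f (j a)‖ ^ 2) (‖comapLin j hj f‖ ^ 2) :=
    ell2_hasSum (comapLin j hj f)
  have h2 := ell2_hasSum f
  refine hasSum_le_inj (f := fun a => ‖f (j a)‖ ^ 2) (g := fun k => ‖f k‖ ^ 2) j hj ?_ ?_ h1 h2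
  · intro c _
    exact sq_nonneg _
  · intro a
    exact le_refl (‖f (j a)‖ ^ 2)

/-- Restriction of coordinates along an injective map of bases:
`(comap j f) a = f (j a)`. Its adjoint sends `|a⟩` to `|j a⟩`. -/
def comap {J K : Type} (j : J → K) (hj : Function.Injective j) : Ell2 K →L[ℂ] Ell2 J :=
  (comapLin j hj).mkContinuous 1 (comapLin_bound j hj)

theorem comap_apply {J K : Type} (j : J → K) (hj : Function.Injective j) (f : Ell2 K) (a : J) :
    comap j hj f a = f (j a) := rfl

/-- The slice `a ↦ f (b, a)` of a vector `f` at a fixed basis label `b` of the second factor. -/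
def slice {A B K : Type} (e : B × A ≃ K) (b : B) : Ell2 K →L[ℂ] Ell2 A :=
  comap (fun a => e (b, a)) (fun _ _ h => (Prod.mk.inj (e.injective h)).2)

theorem ampl_bound {A B K : Type} (e : B × A ≃ K) (T : EllOp A) (f : Ell2 K) :
    ∃ c : ℝ, c ≤ (‖T‖ * ‖f‖) ^ 2 ∧
      HasSum (fun k => ‖T (slice e (e.symm k).1 f) (e.symm k).2‖ ^ 2) c := by
  have h1 : HasSum (fun p : B × A => ‖f (e p)‖ ^ 2) (‖f‖ ^ 2) :=
    (e.hasSum_iff (f := fun k => ‖f k‖ ^ 2)).2 (ell2_hasSum f)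
  have h2 : HasSum (fun b => ‖slice e b f‖ ^ 2) (‖f‖ ^ 2) :=
    h1.prod_fiberwise fun b => ell2_hasSum (slice e b f)
  have h3 : ∀ b, ‖T (slice e b f)‖ ^ 2 ≤ ‖T‖ ^ 2 * ‖slice e b f‖ ^ 2 := fun b => by
    rw [← mul_pow]
    exact pow_le_pow_left₀ (norm_nonneg _) (T.le_opNorm _) 2
  have h4 : Summable fun b => ‖T (slice e b f)‖ ^ 2 :=
    Summable.of_nonneg_of_le (fun _ => sq_nonneg _) h3 (h2.summable.mul_left _)
  have h5 : Summable fun p : B × A => ‖T (slice e p.1 f) p.2‖ ^ 2 := by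
    refine (summable_prod_of_nonneg (fun _ => sq_nonneg _)).2
      ⟨fun b => (ell2_hasSum (T (slice e b f))).summable, ?_⟩
    refine h4.congr fun b => ?_
    exact (ell2_hasSum (T (slice e b f))).tsum_eq.symm
  refine ⟨∑' b, ‖T (slice e b f)‖ ^ 2, ?_, ?_⟩
  · rw [mul_pow]
    exact hasSum_le h3 h4.hasSum (h2.mul_left _)
  · refine (e.hasSum_iff
      (f := fun k => ‖T (slice e (e.symm k).1 f) (e.symm k).2‖ ^ 2)).1 ?_
    have h6 := h5.hasSum.prod_fiberwise fun b => ell2_hasSum (T (slice e b f))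
    rw [h6.tsum_eq]
    simpa [Function.comp_def] using h5.hasSum

/-- The operator `T ⊗ I` as a linear map. -/
def amplLin {A B K : Type} (e : B × A ≃ K) (T : EllOp A) : Ell2 K →ₗ[ℂ] Ell2 K where
  toFun f := mkVec (fun k => T (slice e (e.symm k).1 f) (e.symm k).2)
    (let ⟨_, _, h⟩ := ampl_bound e T f; h.summable)
  map_add' f g := by
    ext k
    simp only [mkVec_apply, map_add, lp.coeFn_add, Pi.add_apply]
  map_smul' c f := by
    ext k
    simp only [mkVec_apply, map_smul, lp.coeFn_smul, Pi.smul_apply, RingHom.id_apply]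

theorem amplLin_bound {A B K : Type} (e : B × A ≃ K) (T : EllOp A) (f : Ell2 K) :
    ‖amplLin e T f‖ ≤ ‖T‖ * ‖f‖ := by
  refine (pow_le_pow_iff_left₀ (norm_nonneg _) (by positivity) two_ne_zero).1 ?_
  obtain ⟨c, hc, h⟩ := ampl_bound e T f
  exact (HasSum.unique (ell2_hasSum (amplLin e T f)) h).trans_le hc

/-- The operator `T ⊗ I` on a space whose basis is identified with a product of bases by `e`:
`T` acts on every slice. -/
def ampl {A B K : Type} (e : B × A ≃ K) (T : EllOp A) : EllOp K :=
  (amplLin e T).mkContinuous ‖T‖ (amplLin_bound e T)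

/-- A scope: for every type, the variables of that type. -/
abbrev Scope : Type 1 := QType → Type

/-- The scope of global quantum variables: countably many names for each type. -/
abbrev Name : Scope := fun _ => ℕ

/-- A global quantum variable: a type and a name. -/
abbrev QVar : Type := (t : QType) × Name t

/-- A list of variables in the scope `V` with prescribed types `ts`. -/
abbrev Tuple (V : Scope) (ts : List QType) : Type := ∀ i : Fin ts.length, V (ts.get i)

/-- The `i`-th entry of a list of global variables, together with its type. -/
def Tuple.var {ts : List QType} (q : Tuple Name ts) (i : Fin ts.length) : QVar := ⟨ts.get i, q i⟩

/-- The finite set of entries of a list of global variables. -/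
def Tuple.vars {ts : List QType} (q : Tuple Name ts) : Finset QVar := Finset.univ.image q.var

/-- The list with one entry. -/
def Tuple.single {V : Scope} {t : QType} (q : V t) : Tuple V [t]
  | ⟨0, _⟩ => q

/-- Basis labels of the tensor product of the spaces of variables of types `ts`. -/
abbrev TupVal (ts : List QType) : Type := ∀ i : Fin ts.length, Val (ts.get i)

/-- The label of `|0 ⋯ 0⟩`. -/
def TupVal.zero (ts : List QType) : TupVal ts := fun i => Val.zero (ts.get i)

/-- Basis labels of the tensor product of the spaces of the variables in `X`. -/
abbrev Assign (X : Finset QVar) : Type := ∀ v : X, Val v.1.1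

/-- Operators on the tensor product of the spaces of the variables in `X`. -/
abbrev Op (X : Finset QVar) : Type := EllOp (Assign X)

/-- `Splits Z q X`: the entries of `q` are pairwise distinct and `X` is the disjoint union of `Z`
and the set of entries of `q`. -/
structure Splits (Z : Finset QVar) {ts : List QType} (q : Tuple Name ts) (X : Finset QVar) :
    Prop where
  inj : Function.Injective q.var
  fresh : ∀ i, q.var i ∉ Z
  mem_iff : ∀ v, v ∈ X ↔ v ∈ Z ∨ ∃ i, q.var i = v

/-- The resulting identification of basis labels: `H_X = H_Z ⊗ H_q`. -/
def Splits.equiv {Z X : Finset QVar} {ts : List QType} {q : Tuple Name ts} (h : Splits Z q X) :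
    Assign Z × TupVal ts ≃ Assign X where
  toFun p := fun v =>
    if hv : ∃ i, q.var i = v.1 then
      cast (congrArg (fun w : QVar => Val w.1) hv.choose_spec) (p.2 hv.choose)
    else p.1 ⟨v.1, ((h.mem_iff v.1).1 v.2).resolve_right hv⟩
  invFun s := (fun v => s ⟨v.1, (h.mem_iff v.1).2 (Or.inl v.2)⟩,
    fun i => s ⟨q.var i, (h.mem_iff _).2 (Or.inr ⟨i, rfl⟩)⟩)
  left_inv := by
    rintro ⟨s, a⟩
    refine Prod.ext ?_ ?_
    · funext v
      have hv : ¬ ∃ i, q.var i = v.1 := fun ⟨i, hi⟩ => h.fresh i (hi ▸ v.2)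
      simp only [dif_neg hv]
    · funext i
      have hv : ∃ j, q.var j = q.var i := ⟨i, rfl⟩
      simp only [dif_pos hv]
      have key : ∀ (j : Fin ts.length) (hj : q.var j = q.var i),
          cast (congrArg (fun w : QVar => Val w.1) hj) (a j) = a i := by
        intro j hj
        obtain rfl := h.inj hj
        rfl
      exact key _ hv.choose_spec
  right_inv := by
    intro s
    funext v
    by_cases hv : ∃ i, q.var i = v.1
    · simp only [dif_pos hv]
      have key : ∀ (w w' : X) (hw : w.1 = w'.1),
          cast (congrArg (fun w : QVar => Val w.1) hw) (s w) = s w' := by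
        rintro ⟨w, hw⟩ ⟨w', hw'⟩ hww
        dsimp only at hww
        subst hww
        rfl
      exact key ⟨q.var hv.choose, _⟩ v hv.choose_spec
    · simp only [dif_neg hv]

/-- The operator `A` on the variables `q`, extended to `X` by the identity on the others. -/
def Splits.lift {Z X : Finset QVar} {ts : List QType} {q : Tuple Name ts} (h : Splits Z q X)
    (A : EllOp (TupVal ts)) : Op X := ampl h.equiv A

/-- The operator `⟨a|_q` from the space of `X` to that of `Z`; its adjoint is `ψ ↦ ψ ⊗ |a⟩_q`. -/
def Splits.bra {Z X : Finset QVar} {ts : List QType} {q : Tuple Name ts} (h : Splits Z q X)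
    (a : TupVal ts) : Ell2 (Assign X) →L[ℂ] Ell2 (Assign Z) :=
  comap (fun s => h.equiv (s, a)) (fun _ _ e => (Prod.mk.inj (h.equiv.injective e)).1)

/-- Initialization of `q`: `∑ i, |0⟩_q⟨i| ρ |i⟩_q⟨0|`. -/
def Splits.reset {Z X : Finset QVar} {ts : List QType} {q : Tuple Name ts} (h : Splits Z q X)
    (ρ : Op X) : Op X :=
  ∑' a : TupVal ts, sandwich
    (h.lift (InnerProductSpace.rankOne ℂ (ket (TupVal.zero ts)) (ket a))) ρ

/-- Extension of a state by default values: `ρ ⊗ |0⟩_q⟨0|`. -/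
def Splits.alloc {Z X : Finset QVar} {ts : List QType} {q : Tuple Name ts} (h : Splits Z q X)
    (ρ : Op Z) : Op X :=
  sandwich (ContinuousLinearMap.adjoint (h.bra (TupVal.zero ts))) ρ

/-- Partial trace over `q`: `∑ i, ⟨i|_q ρ |i⟩_q`. -/
def Splits.ptrace {Z X : Finset QVar} {ts : List QType} {q : Tuple Name ts} (h : Splits Z q X)
    (ρ : Op X) : Op Z :=
  ∑' a : TupVal ts, sandwich (h.bra a) ρ

/-- A canonical list of pairwise distinct variables outside `X`. -/
def freshTuple (X : Finset QVar) (ts : List QType) : Tuple Name ts :=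
  fun i => X.sup (fun v => v.2) + 1 + i.1

theorem splits_freshTuple (X : Finset QVar) (ts : List QType) :
    Splits X (freshTuple X ts) (X ∪ (freshTuple X ts).vars) where
  inj := by
    intro i j h
    have h2 : (Tuple.var (freshTuple X ts) i).2 = (Tuple.var (freshTuple X ts) j).2 :=
      congrArg (fun v : QVar => (show ℕ from v.2)) h
    simp only [Tuple.var, freshTuple] at h2
    exact Fin.ext (Nat.add_left_cancel h2)
  fresh := by
    intro i hi
    have := Finset.le_sup (f := fun v : QVar => (v.2 : ℕ)) hi
    simp only [Tuple.var, freshTuple] at this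
    exact absurd this (by omega)
  mem_iff := by
    intro v
    simp [Tuple.vars]

/-! ### Syntax

Bound variables (local variables and formal parameters) are represented by their position in the
binder, so that statements are identified up to renaming of bound variables and every substitution
of variables is capture-avoiding. -/

/-- The scope `V` extended by binding a list of variables of types `ts`. -/
def Scope.extend (V : Scope) (ts : List QType) : Scope :=
  fun t => V t ⊕ {i : Fin ts.length // ts.get i = t}

/-- A type-preserving map of variables. -/
abbrev Renaming (V W : Scope) : Type := ∀ t, V t → W t

/-- `f[r/q]`, where `q` are the variables bound last: `r` on `q`, and `f` on the others. -/
def Renaming.bind {V W : Scope} (f : Renaming V W) {ts : List QType} (r : Tuple W ts) :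
    Renaming (V.extend ts) W
  | _, .inl v => f _ v
  | _, .inr ⟨i, hi⟩ => hi ▸ r i

/-- A renaming passed under a binder. -/
def Renaming.under {V W : Scope} (f : Renaming V W) (ts : List QType) :
    Renaming (V.extend ts) (W.extend ts) :=
  fun _ => Sum.map (f _) id

/-- A quantum measurement with countably many outcomes: `∑ m, M_m† M_m = I`. -/
structure Measurement (K : Type) where
  outcomes : Set ℕ
  op : outcomes → EllOp K
  complete : ∀ ψ : Ell2 K,
    HasSum (fun m => ContinuousLinearMap.adjoint (op m) (op m ψ)) ψ

/-- The declared procedures, with the types of their formal parameters. -/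
structure Signature where
  procs : ℕ
  params : Fin procs → List QType

/-- The signature without procedures. -/
def Signature.empty : Signature := ⟨0, fun i => i.elim0⟩

/-- Statements with free variables in the scope `V`. -/
inductive Stmt (P : Signature) : Scope → Type 1 where
  | bottom {V : Scope} : Stmt P V
  | skip {V : Scope} : Stmt P V
  | init {V : Scope} {t : QType} (q : V t) : Stmt P V
  | unit {V : Scope} {ts : List QType} (q : Tuple V ts)
      (U : unitary (EllOp (TupVal ts))) : Stmt P V
  | seq {V : Scope} (S₁ S₂ : Stmt P V) : Stmt P V
  | cond {V : Scope} {ts : List QType} (q : Tuple V ts) (M : Measurement (TupVal ts))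
      (S : M.outcomes → Stmt P V) : Stmt P V
  | loc {V : Scope} (ts : List QType) (S : Stmt P (V.extend ts)) : Stmt P V
  | call {V : Scope} (i : Fin P.procs) (p : Tuple V (P.params i)) : Stmt P V

/-- Substitution of variables for variables. -/
def Stmt.rename {P : Signature} : {V W : Scope} → Renaming V W → Stmt P V → Stmt P W
  | _, _, _, .bottom => .bottom
  | _, _, _, .skip => .skip
  | _, _, f, .init q => .init (f _ q)
  | _, _, f, .unit q U => .unit (fun i => f _ (q i)) U
  | _, _, f, .seq S₁ S₂ => .seq (S₁.rename f) (S₂.rename f)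
  | _, _, f, .cond q M S => .cond (fun i => f _ (q i)) M (fun m => (S m).rename f)
  | _, _, f, .loc ts S => .loc ts (S.rename (f.under ts))
  | _, _, f, .call i p => .call i (fun k => f _ (p k))

/-- `S[r/q]`, where `q` are the variables bound last. -/
def Stmt.subst {P : Signature} {V : Scope} {ts : List QType} (S : Stmt P (V.extend ts))
    (r : Tuple V ts) : Stmt P V :=
  S.rename (Renaming.bind (fun _ v => v) r)

/-- All free variables of a statement satisfy `W`. -/
def Stmt.VarsIn {P : Signature} : {V : Scope} → (∀ t, V t → Prop) → Stmt P V → Prop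
  | _, _, .bottom => True
  | _, _, .skip => True
  | _, W, .init q => W _ q
  | _, W, .unit q _ => ∀ i, W _ (q i)
  | _, W, .seq S₁ S₂ => S₁.VarsIn W ∧ S₂.VarsIn W
  | _, W, .cond q _ S => (∀ i, W _ (q i)) ∧ ∀ m, (S m).VarsIn W
  | _, W, .loc _ S => S.VarsIn (fun t => Sum.elim (W t) (fun _ => True))
  | _, W, .call _ p => ∀ i, W _ (p i)

/-- A declaration of mutually recursive procedures. A body may refer to its formal parameters and
to global variables. -/
structure Decl (P : Signature) where
  body : ∀ i, Stmt P (Name.extend (P.params i))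

/-- All variables of `S` belong to `X`. -/
def Stmt.VarsSubset {P : Signature} (S : Stmt P Name) (X : Finset QVar) : Prop :=
  S.VarsIn (fun t v => (⟨t, v⟩ : QVar) ∈ X)

/-- All global variables of the declared procedures belong to `X`. -/
def Decl.VarsSubset {P : Signature} (D : Decl P) (X : Finset QVar) : Prop :=
  ∀ i, (D.body i).VarsIn (fun t => Sum.elim (fun v => (⟨t, v⟩ : QVar) ∈ X) (fun _ => True))

/-! ### Operational semantics -/

/-- Transition labels: `eps` for deterministic steps, otherwise a measurement outcome. -/
inductive Label where
  | eps
  | out (m : ℕ)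

/-- Programs at run time: the empty program `E`, a statement, the release of
variables, and sequential compositions. -/
inductive Run (P : Signature) where
  | done : Run P
  | stmt (S : Stmt P Name) : Run P
  | release {ts : List QType} (r : Tuple Name ts) : Run P
  | seq (R₁ R₂ : Run P) : Run P

/-- A quantum state: its variables and an operator on their space. -/
structure QState where
  vars : Finset QVar
  op : Op vars

/-- Quantum configurations. -/
structure Config (P : Signature) where
  prog : Run P
  state : QState

/-- One-step transitions between configurations. The rule `stmt_seq` says that `S₁; S₂` is the
same as a statement and as a composition of run-time programs. -/
inductive Step {P : Signature} (D : Decl P) : Config P → Label → Config P → Prop where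
  | bottom {X : Finset QVar} (ρ : Op X) :
      Step D ⟨.stmt .bottom, ⟨X, ρ⟩⟩ .eps ⟨.done, ⟨X, 0⟩⟩
  | skip {X : Finset QVar} (ρ : Op X) :
      Step D ⟨.stmt .skip, ⟨X, ρ⟩⟩ .eps ⟨.done, ⟨X, ρ⟩⟩
  | init {X Z : Finset QVar} (ρ : Op X) {t : QType} (q : Name t)
      (h : Splits Z (Tuple.single (V := Name) q) X) :
      Step D ⟨.stmt (.init q), ⟨X, ρ⟩⟩ .eps ⟨.done, ⟨X, h.reset ρ⟩⟩
  | unit {X Z : Finset QVar} (ρ : Op X) {ts : List QType} (q : Tuple Name ts)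
      (U : unitary (EllOp (TupVal ts))) (h : Splits Z q X) :
      Step D ⟨.stmt (.unit q U), ⟨X, ρ⟩⟩ .eps ⟨.done, ⟨X, sandwich (h.lift U) ρ⟩⟩
  | cond {X Z : Finset QVar} (ρ : Op X) {ts : List QType} (q : Tuple Name ts)
      (M : Measurement (TupVal ts)) (S : M.outcomes → Stmt P Name) (h : Splits Z q X)
      (m : M.outcomes) :
      Step D ⟨.stmt (.cond q M S), ⟨X, ρ⟩⟩ (.out m)
        ⟨.stmt (S m), ⟨X, sandwich (h.lift (M.op m)) ρ⟩⟩
  | loc {X Y : Finset QVar} (ρ : Op X) {ts : List QType} (S : Stmt P (Name.extend ts))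
      (r : Tuple Name ts) (h : Splits X r Y) :
      Step D ⟨.stmt (.loc ts S), ⟨X, ρ⟩⟩ .eps
        ⟨.seq (.stmt (S.subst r)) (.release r), ⟨Y, h.alloc ρ⟩⟩
  | release {X Y : Finset QVar} (ρ : Op Y) {ts : List QType} (r : Tuple Name ts)
      (h : Splits X r Y) :
      Step D ⟨.release r, ⟨Y, ρ⟩⟩ .eps ⟨.done, ⟨X, h.ptrace ρ⟩⟩
  | call {X : Finset QVar} (ρ : Op X) (i : Fin P.procs) (p : Tuple Name (P.params i)) :
      Step D ⟨.stmt (.call i p), ⟨X, ρ⟩⟩ .eps ⟨.stmt ((D.body i).subst p), ⟨X, ρ⟩⟩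
  | comp₁ {R₁ R₁' R₂ : Run P} {σ σ' : QState} {l : Label} :
      Step D ⟨R₁, σ⟩ l ⟨R₁', σ'⟩ → R₁' ≠ .done →
      Step D ⟨.seq R₁ R₂, σ⟩ l ⟨.seq R₁' R₂, σ'⟩
  | comp₂ {R₁ R₂ : Run P} {σ σ' : QState} {l : Label} :
      Step D ⟨R₁, σ⟩ l ⟨.done, σ'⟩ → Step D ⟨.seq R₁ R₂, σ⟩ l ⟨R₂, σ'⟩
  | stmt_seq {S₁ S₂ : Stmt P Name} {σ : QState} {l : Label} {C : Config P} :
      Step D ⟨.seq (.stmt S₁) (.stmt S₂), σ⟩ l C → Step D ⟨.stmt (.seq S₁ S₂), σ⟩ l C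

/-- Labelled transitions into a configuration, or into the failure state `none` when no other
rule applies. -/
def Trans {P : Signature} (D : Decl P) (C : Config P) (l : Label) : Option (Config P) → Prop
  | some C' => Step D C l C'
  | none => ¬ ∃ C', Step D C l C'

/-- Multi-step transitions, labelled by nonempty sequences of labels. -/
inductive Exec {P : Signature} (D : Decl P) :
    Config P → List Label → Option (Config P) → Prop where
  | single {C : Config P} {l : Label} {C' : Option (Config P)} :
      Trans D C l C' → Exec D C [l] C'
  | cons {C C' : Config P} {l : Label} {α : List Label} {C'' : Option (Config P)} :
      Trans D C l (some C') → Exec D C' α C'' → Exec D C (l :: α) C''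

/-- `⟨S, σ⟩ →α ⟨E, σ'⟩`. -/
def Reaches {P : Signature} (D : Decl P) (S : Stmt P Name) (σ : QState) (α : List Label)
    (σ' : QState) : Prop :=
  Exec D ⟨.stmt S, σ⟩ α (some ⟨.done, σ'⟩)

/-! ### Denotational semantics -/

/-- A super-operator for every finite set of variables on which the state may live. -/
abbrev Den : Type := ∀ X : Finset QVar, Op X → Op X

/-- The denotation of `S[f]` for a renaming `f` of the variables in scope by global ones, given the
denotations `κ` of procedure calls. An operation whose side condition fails (variables repeated in
its list, or absent from the state) has no successful execution, and denotes `0`. -/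
def Stmt.denWith {P : Signature} (κ : ∀ i, Tuple Name (P.params i) → Den) :
    {V : Scope} → Stmt P V → Renaming V Name → Den
  | _, .bottom, _ => fun _ _ => 0
  | _, .skip, _ => fun _ ρ => ρ
  | _, .init q, f => fun X ρ =>
      if h : Splits (X \ (Tuple.single (V := Name) (f _ q)).vars)
        (Tuple.single (V := Name) (f _ q)) X then h.reset ρ else 0
  | _, .unit q U, f => fun X ρ =>
      if h : Splits (X \ Tuple.vars fun i => f _ (q i)) (fun i => f _ (q i)) X
      then sandwich (h.lift U) ρ else 0
  | _, .seq S₁ S₂, f => fun X ρ => S₂.denWith κ f X (S₁.denWith κ f X ρ)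
  | _, .cond q M S, f => fun X ρ =>
      if h : Splits (X \ Tuple.vars fun i => f _ (q i)) (fun i => f _ (q i)) X
      then ∑' m, (S m).denWith κ f X (sandwich (h.lift (M.op m)) ρ) else 0
  | _, .loc ts S, f => fun X ρ =>
      (splits_freshTuple X ts).ptrace
        (S.denWith κ (f.bind (freshTuple X ts)) _ ((splits_freshTuple X ts).alloc ρ))
  | _, .call i p, f => κ i (fun k => f _ (p k))

/-- The denotation of a statement without procedure calls. -/
def Stmt.den₀ (S : Stmt Signature.empty Name) : Den :=
  S.denWith (fun i => i.elim0) (fun _ v => v)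

/-- Replacement of every call `call j (p)` by `skip; B j [p/y]`, where `B j` has the formal
parameters `y`; `g` places the global variables in the current scope. -/
def Stmt.unroll {P : Signature}
    (B : ∀ j, Stmt Signature.empty (Name.extend (P.params j))) :
    {V : Scope} → Stmt P V → Renaming Name V → Stmt Signature.empty V
  | _, .bottom, _ => .bottom
  | _, .skip, _ => .skip
  | _, .init q, _ => .init q
  | _, .unit q U, _ => .unit q U
  | _, .seq S₁ S₂, g => .seq (S₁.unroll B g) (S₂.unroll B g)
  | _, .cond q M S, g => .cond q M (fun m => (S m).unroll B g)
  | _, .loc ts S, g => .loc ts (S.unroll B (fun _ v => .inl (g _ v)))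
  | _, .call j p, g => .seq .skip ((B j).rename (g.bind p))

/-- The syntactic approximations of the procedure bodies. -/
def Decl.approx {P : Signature} (D : Decl P) :
    ℕ → ∀ i, Stmt Signature.empty (Name.extend (P.params i))
  | 0, _ => .bottom
  | k + 1, i => (D.body i).unroll (D.approx k) (fun _ v => .inl v)

/-- The least upper bound of a sequence of operators in the Löwner order, and `0` if there is
none. -/
def lub {X : Finset QVar} (A : ℕ → Op X) : Op X :=
  if h : ∃ T, IsLUB (Set.range A) T then h.choose else 0

/-- The denotation of a procedure call. -/
def Decl.denCall {P : Signature} (D : Decl P) (i : Fin P.procs)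
    (p : Tuple Name (P.params i)) : Den :=
  fun X ρ => lub fun k => ((D.approx k i).subst p).den₀ X ρ

/-- The denotation of a statement in the presence of a declaration. -/
def Decl.den {P : Signature} (D : Decl P) (S : Stmt P Name) : Den :=
  S.denWith D.denCall (fun _ v => v)

end RQP

end

noncomputable section

open Classical
open scoped ENNReal

namespace RQP


/-! ### The trace of positive operators -/

/-! A terminating computation is encoded as a branch: its label word together with the map that it
applies to the state. `Stmt.branches` builds these by recursion on the statement, always
instantiating local variables by one canonical fresh tuple; calls are resolved by recursion on
depth. The theorem then splits into two claims: the denotation is the sum of the branches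
(`Stmt.resolves`, `Decl.resolves_allCallBranches`), and the branches are exactly the terminating
executions (`reaches_iff`).

For the first claim the invariant is that the branches form an instrument with prefix-free labels:
each map preserves positivity and is countably additive, and the traces of all outputs add up to at
most the trace of the input. The operator norm of a positive operator is at most its trace
(`enorm_le_otr`), so the trace bound gives absolute convergence and allows the double sums of
sequential composition to be rearranged. Prefix-freeness makes the decomposition of a concatenated
label word unique and yields determinism. For a call, the branches of depth at most `k` sum to the
denotation of the `k`-th syntactic approximation and increase with `k`; each finite set of branches
occurs at a single depth, so the sum over their union is the least upper bound (`resolves_isLUB`).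

For the second claim, branches are executed directly. Conversely, an execution may pick other fresh
local variables than the canonical ones. The two choices differ by a renaming that fixes the outer
variables, branches commute with renamings (`Stmt.branches_relabel`), and the partial trace removes
the difference. -/

theorem inner_ket {K : Type} (k : K) (x : Ell2 K) : inner ℂ (ket k) x = x k := by
  rw [ket, lp.inner_single_left]
  simp

theorem tsum_enorm_sq {K : Type} (x : Ell2 K) : ∑' k, ‖x k‖ₑ ^ 2 = ‖x‖ₑ ^ 2 := by
  have h := ell2_hasSum x
  have h2 : ∀ z : ℝ, 0 ≤ z → ENNReal.ofReal z ^ 2 = ENNReal.ofReal (z ^ 2) := fun z hz =>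
    (ENNReal.ofReal_pow hz 2).symm
  simp only [← ofReal_norm]
  rw [h2 _ (norm_nonneg _), ← h.tsum_eq, ENNReal.ofReal_tsum_of_nonneg (fun _ => sq_nonneg _)
    h.summable]
  exact tsum_congr fun k => h2 _ (norm_nonneg _)

/-- The Hilbert–Schmidt norm of an operator and of its adjoint agree. -/
theorem tsum_enorm_adjoint {J K : Type} (T : Ell2 J →L[ℂ] Ell2 K) :
    ∑' j, ‖T (ket j)‖ₑ ^ 2 = ∑' k, ‖ContinuousLinearMap.adjoint T (ket k)‖ₑ ^ 2 := by
  simp only [← tsum_enorm_sq]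
  rw [ENNReal.tsum_comm]
  refine tsum_congr fun k => tsum_congr fun j => ?_
  rw [← inner_ket, ← inner_ket, ContinuousLinearMap.adjoint_inner_right,
    ← ofReal_norm, ← ofReal_norm, norm_inner_symm]

/-- The trace of a positive operator. -/
def otr {K : Type} (ρ : EllOp K) : ℝ≥0∞ :=
  ∑' k, ENNReal.ofReal (inner ℂ (ket k) (ρ (ket k))).re

theorem otr_eq_of_factor {J K : Type} (B : Ell2 K →L[ℂ] Ell2 J) :
    otr (ContinuousLinearMap.adjoint B ∘L B) = ∑' k, ‖B (ket k)‖ₑ ^ 2 := by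
  refine tsum_congr fun k => ?_
  rw [ContinuousLinearMap.comp_apply, ContinuousLinearMap.adjoint_inner_right,
    ← ofReal_norm, ← ENNReal.ofReal_pow (norm_nonneg _), inner_self_eq_norm_sq_to_K]
  norm_cast

theorem exists_star_mul_self {A : Type*} [CStarAlgebra A] [PartialOrder A] [StarOrderedRing A]
    {a : A} (h : 0 ≤ a) : ∃ b, a = star b * b :=
  CStarAlgebra.nonneg_iff_eq_star_mul_self.1 h

theorem exists_factor {K : Type} {ρ : EllOp K} (h : 0 ≤ ρ) :
    ∃ B : EllOp K, ρ = ContinuousLinearMap.adjoint B ∘L B :=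
  exists_star_mul_self h

/-- For `ρ = B†B`, Parseval and Cauchy–Schwarz applied to `⟨k, B x⟩ = ⟨B† k, x⟩` bound the operator
norm of `B` by its Hilbert–Schmidt norm, whose square is the trace of `ρ`. -/
theorem enorm_le_otr {K : Type} {ρ : EllOp K} (h : 0 ≤ ρ) : ‖ρ‖ₑ ≤ otr ρ := by
  obtain ⟨B, rfl⟩ := exists_factor h
  rw [otr_eq_of_factor]
  by_cases ht : ∑' k, ‖B (ket k)‖ₑ ^ 2 = ∞
  · rw [ht]; exact le_top
  have key : ∀ x, ‖B x‖ₑ ^ 2 ≤ (∑' k, ‖B (ket k)‖ₑ ^ 2) * ‖x‖ₑ ^ 2 := by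
    intro x
    rw [tsum_enorm_adjoint, ← tsum_enorm_sq (B x), ← ENNReal.tsum_mul_right]
    refine ENNReal.tsum_le_tsum fun k => ?_
    rw [← mul_pow, ← inner_ket, ← ContinuousLinearMap.adjoint_inner_left]
    gcongr
    rw [← ofReal_norm, ← ofReal_norm, ← ofReal_norm, ← ENNReal.ofReal_mul (norm_nonneg _)]
    exact ENNReal.ofReal_le_ofReal (norm_inner_le_norm _ _)
  set t := ∑' k, ‖B (ket k)‖ₑ ^ 2 with htdef
  have h2 : ‖ContinuousLinearMap.adjoint B ∘L B‖ = ‖B‖ * ‖B‖ :=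
    ContinuousLinearMap.norm_adjoint_comp_self B
  have h3 : ‖B‖ ≤ Real.sqrt t.toReal := by
    refine ContinuousLinearMap.opNorm_le_bound _ (Real.sqrt_nonneg _) fun x => ?_
    refine (pow_le_pow_iff_left₀ (norm_nonneg _) (by positivity) two_ne_zero).1 ?_
    rw [mul_pow, Real.sq_sqrt ENNReal.toReal_nonneg]
    have := ENNReal.toReal_mono (ENNReal.mul_ne_top ht (by simp)) (key x)
    simpa using this
  rw [← ofReal_norm, h2]
  refine ENNReal.ofReal_le_of_le_toReal ?_
  calc ‖B‖ * ‖B‖ ≤ Real.sqrt t.toReal * Real.sqrt t.toReal := by gcongr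
    _ = t.toReal := Real.mul_self_sqrt ENNReal.toReal_nonneg

theorem sandwich_nonneg {J K : Type} (A : Ell2 J →L[ℂ] Ell2 K) {ρ : EllOp J} (h : 0 ≤ ρ) :
    0 ≤ sandwich A ρ := by
  rw [ContinuousLinearMap.nonneg_iff_isPositive] at h ⊢
  exact h.conj_adjoint A

/-- A family of operators with `∑ j, A_j† A_j ≤ I`. -/
def Contractive {J K I : Type} (A : I → Ell2 J →L[ℂ] Ell2 K) : Prop :=
  ∀ x, ∑' i, ‖A i x‖ₑ ^ 2 ≤ ‖x‖ₑ ^ 2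

/-- With `ρ = B†B`, the trace of `A_i ρ A_i†` is the squared Hilbert–Schmidt norm of `A_i B†`. After
exchanging the sums, contractivity applies to each vector `B† |j⟩` separately. -/
theorem otr_sandwich_le {J K I : Type} {A : I → Ell2 J →L[ℂ] Ell2 K} (hA : Contractive A)
    {ρ : EllOp J} (h : 0 ≤ ρ) : ∑' i, otr (sandwich (A i) ρ) ≤ otr ρ := by
  obtain ⟨B, rfl⟩ := exists_factor h
  have h1 : ∀ i, otr (sandwich (A i) (ContinuousLinearMap.adjoint B ∘L B)) =
      ∑' j, ‖A i (ContinuousLinearMap.adjoint B (ket j))‖ₑ ^ 2 := by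
    intro i
    have h2 : sandwich (A i) (ContinuousLinearMap.adjoint B ∘L B) =
        ContinuousLinearMap.adjoint (B ∘L ContinuousLinearMap.adjoint (A i)) ∘L
          (B ∘L ContinuousLinearMap.adjoint (A i)) := by
      rw [ContinuousLinearMap.adjoint_comp, ContinuousLinearMap.adjoint_adjoint]
      rfl
    rw [h2, otr_eq_of_factor, tsum_enorm_adjoint, ContinuousLinearMap.adjoint_comp,
      ContinuousLinearMap.adjoint_adjoint]
    rfl
  simp only [h1]
  rw [ENNReal.tsum_comm, otr_eq_of_factor, tsum_enorm_adjoint]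
  exact ENNReal.tsum_le_tsum fun j => hA _

theorem hasSum_sandwich {J K I : Type} (A : Ell2 J →L[ℂ] Ell2 K) {ρ : I → EllOp J} {σ : EllOp J}
    (h : HasSum ρ σ) : HasSum (fun i => sandwich A (ρ i)) (sandwich A σ) := by
  have h1 := h.mapL ((ContinuousLinearMap.compL ℂ (Ell2 K) (Ell2 J) (Ell2 J)).flip
    (ContinuousLinearMap.adjoint A))
  exact h1.mapL (ContinuousLinearMap.compL ℂ (Ell2 K) (Ell2 J) (Ell2 K) A)

/-- Norm convergence gives convergence of each diagonal entry; these are nonnegative, so the two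
sums may be exchanged. -/
theorem otr_hasSum {K I : Type} {ρ : I → EllOp K} {σ : EllOp K} (hρ : ∀ i, 0 ≤ ρ i)
    (h : HasSum ρ σ) : otr σ = ∑' i, otr (ρ i) := by
  unfold otr
  rw [ENNReal.tsum_comm]
  refine tsum_congr fun k => ?_
  have h1 : HasSum (fun i => (inner ℂ (ket k) (ρ i (ket k))).re) (inner ℂ (ket k) (σ (ket k))).re :=
    ((h.mapL (ContinuousLinearMap.apply ℂ (Ell2 K) (ket k))).mapL
      (innerSL ℂ (ket k))).mapL Complex.reCLM
  rw [← h1.tsum_eq, ENNReal.ofReal_tsum_of_nonneg (fun i => ?_) h1.summable]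
  have := ((ContinuousLinearMap.nonneg_iff_isPositive _).1 (hρ i)).inner_nonneg_right (ket k)
  exact (Complex.le_def.1 this).1

theorem summable_of_otr {K I : Type} {ρ : I → EllOp K} (hρ : ∀ i, 0 ≤ ρ i)
    (h : ∑' i, otr (ρ i) ≠ ∞) : Summable ρ := by
  refine Summable.of_norm ?_
  have h1 : ∑' i, ‖ρ i‖ₑ ≠ ∞ :=
    ne_top_of_le_ne_top h (ENNReal.tsum_le_tsum fun i => enorm_le_otr (hρ i))
  have := ENNReal.summable_toReal h1
  simpa using this

/-- Positive trace-class operators. -/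
def IsPTC {K : Type} (ρ : EllOp K) : Prop := 0 ≤ ρ ∧ otr ρ ≠ ∞

theorem IsPDOP.isPTC {K : Type} {ρ : EllOp K} (h : IsPDOP ρ) : IsPTC ρ := by
  obtain ⟨h0, c, -, hc⟩ := h
  refine ⟨(ContinuousLinearMap.nonneg_iff_isPositive _).2 h0, ?_⟩
  unfold otr
  rw [← ENNReal.ofReal_tsum_of_nonneg (fun i => ?_) hc.summable]
  · exact ENNReal.ofReal_ne_top
  · exact (Complex.le_def.1 (h0.inner_nonneg_right (ket i))).1

/-! ### Instruments -/

/-- A family of trace-nonincreasing, countably additive maps of positive trace-class operators,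
with sum `Ψ`. -/
structure IsInstr {J K I : Type} (Φ : I → EllOp J → EllOp K) (Ψ : EllOp J → EllOp K) : Prop where
  nonneg : ∀ i ρ, IsPTC ρ → 0 ≤ Φ i ρ
  trace_le : ∀ ρ, IsPTC ρ → ∑' i, otr (Φ i ρ) ≤ otr ρ
  additive : ∀ i (N : Type) (ρ : N → EllOp J) (σ : EllOp J), (∀ n, IsPTC (ρ n)) →
    ∑' n, otr (ρ n) ≠ ∞ → HasSum ρ σ → HasSum (fun n => Φ i (ρ n)) (Φ i σ)
  hasSum : ∀ ρ, IsPTC ρ → HasSum (fun i => Φ i ρ) (Ψ ρ)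

namespace IsInstr

variable {J K L I : Type}

theorem isPTC {Φ : I → EllOp J → EllOp K} {Ψ : EllOp J → EllOp K} (h : IsInstr Φ Ψ) (i : I)
    {ρ : EllOp J} (hρ : IsPTC ρ) : IsPTC (Φ i ρ) :=
  ⟨h.nonneg i ρ hρ, ne_top_of_le_ne_top hρ.2
    ((ENNReal.le_tsum (f := fun i => otr (Φ i ρ)) i).trans (h.trace_le ρ hρ))⟩

theorem total_nonneg {Φ : I → EllOp J → EllOp K} {Ψ : EllOp J → EllOp K} (h : IsInstr Φ Ψ)
    {ρ : EllOp J} (hρ : IsPTC ρ) : 0 ≤ Ψ ρ :=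
  HasSum.nonneg (fun i => h.nonneg i ρ hρ) (h.hasSum ρ hρ)

theorem total_otr {Φ : I → EllOp J → EllOp K} {Ψ : EllOp J → EllOp K} (h : IsInstr Φ Ψ)
    {ρ : EllOp J} (hρ : IsPTC ρ) : otr (Ψ ρ) ≤ otr ρ := by
  rw [otr_hasSum (fun i => h.nonneg i ρ hρ) (h.hasSum ρ hρ)]
  exact h.trace_le ρ hρ

/-- The sum of an instrument is countably additive. -/
theorem total_additive {Φ : I → EllOp J → EllOp K} {Ψ : EllOp J → EllOp K} (h : IsInstr Φ Ψ)
    (N : Type) (ρ : N → EllOp J) (σ : EllOp J) (hρ : ∀ n, IsPTC (ρ n))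
    (ht : ∑' n, otr (ρ n) ≠ ∞) (hs : HasSum ρ σ) : HasSum (fun n => Ψ (ρ n)) (Ψ σ) := by
  have hσ : IsPTC σ :=
    ⟨HasSum.nonneg (fun n => (hρ n).1) hs, by rwa [otr_hasSum (fun n => (hρ n).1) hs]⟩
  -- The traces of the double family sum to at most `∑' n, otr (ρ n)`, so it converges absolutely
  -- and may be summed over outcomes or over `n` first.
  have h1 : Summable fun p : (_ : I) × N => Φ p.1 (ρ p.2) := by
    refine summable_of_otr (fun p => h.nonneg p.1 _ (hρ p.2)) ?_
    rw [ENNReal.tsum_sigma (fun i n => otr (Φ i (ρ n))), ENNReal.tsum_comm]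
    exact ne_top_of_le_ne_top ht (ENNReal.tsum_le_tsum fun n => h.trace_le _ (hρ n))
  have h2 : HasSum (fun p : (_ : I) × N => Φ p.1 (ρ p.2)) (Ψ σ) :=
    HasSum.sigma_of_hasSum (h.hasSum σ hσ) (fun i => h.additive i N ρ σ hρ ht hs) h1
  let e : (_ : N) × I ≃ (_ : I) × N :=
    ⟨fun p => ⟨p.2, p.1⟩, fun p => ⟨p.2, p.1⟩, fun _ => rfl, fun _ => rfl⟩
  have h3 := (e.hasSum_iff (f := fun p : (_ : I) × N => Φ p.1 (ρ p.2))).2 h2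
  exact h3.sigma fun n => h.hasSum _ (hρ n)

theorem total {Φ : I → EllOp J → EllOp K} {Ψ : EllOp J → EllOp K} (h : IsInstr Φ Ψ) :
    IsInstr (fun _ : Unit => Ψ) Ψ where
  nonneg _ _ hρ := h.total_nonneg hρ
  trace_le ρ hρ := by simpa using h.total_otr hρ
  additive _ := h.total_additive
  hasSum ρ _ := hasSum_unique (fun _ : Unit => Ψ ρ)

theorem reindex {I' : Type} {Φ : I → EllOp J → EllOp K} {Φ' : I' → EllOp J → EllOp K}
    {Ψ : EllOp J → EllOp K} (h : IsInstr Φ Ψ) (e : I' ≃ I) (he : ∀ i, Φ' i = Φ (e i)) :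
    IsInstr Φ' Ψ := by
  obtain rfl : Φ' = fun i => Φ (e i) := funext he
  exact
  { nonneg := fun i => h.nonneg (e i)
    trace_le := fun ρ hρ => by
      rw [e.tsum_eq (fun i => otr (Φ i ρ))]; exact h.trace_le ρ hρ
    additive := fun i => h.additive (e i)
    hasSum := fun ρ hρ => (e.hasSum_iff (f := fun i => Φ i ρ)).2 (h.hasSum ρ hρ) }

theorem congr_total {Φ : I → EllOp J → EllOp K} {Ψ Ψ' : EllOp J → EllOp K} (h : IsInstr Φ Ψ)
    (h' : ∀ ρ, IsPTC ρ → Ψ ρ = Ψ' ρ) : IsInstr Φ Ψ' :=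
  { h with hasSum := fun ρ hρ => h' ρ hρ ▸ h.hasSum ρ hρ }

/-- Sequential composition, where the second instrument may depend on the outcome of the first. -/
theorem sigma {I' : I → Type} {Φ : I → EllOp J → EllOp K} {Ψ : EllOp J → EllOp K}
    {Φ' : ∀ i, I' i → EllOp K → EllOp L} {Ψ' : I → EllOp K → EllOp L} (h : IsInstr Φ Ψ)
    (h' : ∀ i, IsInstr (Φ' i) (Ψ' i)) :
    IsInstr (fun (p : (i : I) × I' i) ρ => Φ' p.1 p.2 (Φ p.1 ρ))
      (fun ρ => ∑' i, Ψ' i (Φ i ρ)) := by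
  have ht : ∀ ρ, IsPTC ρ →
      ∑' p : (i : I) × I' i, otr (Φ' p.1 p.2 (Φ p.1 ρ)) ≤ otr ρ := by
    intro ρ hρ
    rw [ENNReal.tsum_sigma (fun i j => otr (Φ' i j (Φ i ρ)))]
    exact (ENNReal.tsum_le_tsum fun i => (h' i).trace_le _ (h.isPTC i hρ)).trans (h.trace_le ρ hρ)
  refine ⟨fun p ρ hρ => (h' p.1).nonneg p.2 _ (h.isPTC p.1 hρ), ht, ?_, ?_⟩
  · intro p N ρ σ hρ hs hsum
    refine (h' p.1).additive p.2 N _ _ (fun n => h.isPTC p.1 (hρ n)) ?_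
      (h.additive p.1 N ρ σ hρ hs hsum)
    refine ne_top_of_le_ne_top hs (ENNReal.tsum_le_tsum fun n => ?_)
    exact (ENNReal.le_tsum (f := fun i => otr (Φ i (ρ n))) p.1).trans (h.trace_le _ (hρ n))
  · intro ρ hρ
    have hs : Summable fun p : (i : I) × I' i => Φ' p.1 p.2 (Φ p.1 ρ) :=
      summable_of_otr (fun p => (h' p.1).nonneg p.2 _ (h.isPTC p.1 hρ))
        (ne_top_of_le_ne_top hρ.2 (ht ρ hρ))
    have h1 := hs.hasSum.sigma fun i => (h' i).hasSum _ (h.isPTC i hρ)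
    rw [h1.tsum_eq]
    exact hs.hasSum

/-- Here the second instrument does not depend on the first outcome, and its countable additivity
turns the sum of the `Ψ' (Φ i ρ)` into `Ψ' (Ψ ρ)`. -/
theorem seq {I' : Type} {Φ : I → EllOp J → EllOp K} {Ψ : EllOp J → EllOp K}
    {Φ' : I' → EllOp K → EllOp L} {Ψ' : EllOp K → EllOp L} (h : IsInstr Φ Ψ)
    (h' : IsInstr Φ' Ψ') :
    IsInstr (fun (p : I × I') ρ => Φ' p.2 (Φ p.1 ρ)) (fun ρ => Ψ' (Ψ ρ)) := by
  refine ((h.sigma fun _ => h').congr_total fun ρ hρ => ?_).reindex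
    (Equiv.sigmaEquivProd I I').symm fun _ => rfl
  refine (h'.total_additive I _ _ (fun i => h.isPTC i hρ) ?_ (h.hasSum ρ hρ)).tsum_eq
  exact ne_top_of_le_ne_top hρ.2 (h.trace_le ρ hρ)

/-- A contractive family of operators as an instrument. -/
theorem kraus {A : I → Ell2 J →L[ℂ] Ell2 K} (hA : Contractive A) :
    IsInstr (fun i => sandwich (A i)) (fun ρ => ∑' i, sandwich (A i) ρ) where
  nonneg i _ hρ := sandwich_nonneg (A i) hρ.1
  trace_le _ hρ := otr_sandwich_le hA hρ.1
  additive i _ _ _ _ _ hs := hasSum_sandwich (A i) hs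
  hasSum _ hρ := (summable_of_otr (fun i => sandwich_nonneg (A i) hρ.1)
    (ne_top_of_le_ne_top hρ.2 (otr_sandwich_le hA hρ.1))).hasSum

theorem single {A : Ell2 J →L[ℂ] Ell2 K} (hA : ∀ x, ‖A x‖ ≤ ‖x‖) :
    IsInstr (fun _ : Unit => sandwich A) (sandwich A) := by
  refine (kraus (A := fun _ : Unit => A) fun x => ?_).congr_total fun ρ _ => by simp
  rw [tsum_fintype, Finset.univ_unique, Finset.sum_singleton, ← ofReal_norm,
    ← ofReal_norm]
  gcongr
  exact hA x

theorem zero : IsInstr (fun _ : Unit => fun _ : EllOp J => (0 : EllOp K)) (fun _ => 0) where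
  nonneg _ _ _ := le_rfl
  trace_le _ _ := by simp [otr]
  additive _ _ _ _ _ _ _ := hasSum_zero
  hasSum _ _ := hasSum_zero

theorem id : IsInstr (fun _ : Unit => fun ρ : EllOp J => ρ) (fun ρ => ρ) where
  nonneg _ _ hρ := hρ.1
  trace_le ρ _ := by simp
  additive _ _ _ _ _ _ h := h
  hasSum ρ _ := hasSum_unique (fun _ : Unit => ρ)

/-- Covers situations without any branch: failed side conditions and calls at depth zero. -/
theorem empty [IsEmpty I] {Φ : I → EllOp J → EllOp K} : IsInstr Φ (fun _ => 0) where
  nonneg i := isEmptyElim i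
  trace_le _ _ := by simp
  additive i := isEmptyElim i
  hasSum _ _ := hasSum_empty

end IsInstr

/-! ### Elementary quantum operations -/

/-- The squared norm of a vector is the sum over its slices, and `T ⊗ I` acts on each slice by `T`.
-/
theorem Contractive.ampl {A B K I : Type} (e : B × A ≃ K) {T : I → EllOp A} (hT : Contractive T) :
    Contractive fun i => ampl e (T i) := by
  intro x
  have h1 : ∀ y : Ell2 K, ‖y‖ₑ ^ 2 = ∑' b, ‖slice e b y‖ₑ ^ 2 := by
    intro y
    rw [← tsum_enorm_sq, ← e.tsum_eq, ENNReal.tsum_prod (f := fun b a => ‖y (e (b, a))‖ₑ ^ 2)]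
    exact tsum_congr fun b => tsum_enorm_sq (slice e b y)
  have h2 : ∀ i b, slice e b (RQP.ampl e (T i) x) = T i (slice e b x) := by
    intro i b
    ext a
    change T i (slice e (e.symm (e (b, a))).1 x) (e.symm (e (b, a))).2 = _
    rw [e.symm_apply_apply]
  simp only [h1 (RQP.ampl e (T _) x), h2]
  rw [ENNReal.tsum_comm, h1 x]
  exact ENNReal.tsum_le_tsum fun b => hT _

theorem contractive_rankOne {K : Type} (z : K) :
    Contractive fun a : K => InnerProductSpace.rankOne ℂ (ket z) (ket a) := by
  intro x
  have hz : ‖ket z‖ = 1 := by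
    rw [ket, lp.norm_single (by norm_num)]; simp
  have : ∀ a, ‖InnerProductSpace.rankOne ℂ (ket z) (ket a) x‖ₑ = ‖x a‖ₑ := fun a => by
    rw [InnerProductSpace.rankOne_apply, inner_ket, ← ofReal_norm, norm_smul, hz, mul_one,
      ofReal_norm]
  simp only [this]
  exact (tsum_enorm_sq x).le

/-- Pairing the completeness relation at `x` with `x` itself gives equality of the squared norms. -/
theorem Measurement.contractive {K : Type} (M : Measurement K) : Contractive M.op := by
  intro x
  have h1 : HasSum (fun m => ‖M.op m x‖ ^ 2) (‖x‖ ^ 2) := by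
    have h := ((M.complete x).mapL (innerSL ℂ x)).mapL Complex.reCLM
    have h2 : ∀ y : Ell2 K, Complex.reCLM (inner ℂ y y) = ‖y‖ ^ 2 := fun y => by
      rw [inner_self_eq_norm_sq_to_K, ← RCLike.ofReal_pow]
      exact Complex.ofReal_re _
    simp only [innerSL_apply_apply, ContinuousLinearMap.adjoint_inner_right, h2] at h
    exact h
  simp only [← ofReal_norm, ← ENNReal.ofReal_pow (norm_nonneg _)]
  rw [← h1.tsum_eq, ENNReal.ofReal_tsum_of_nonneg (fun _ => sq_nonneg _) h1.summable]

namespace Splits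

variable {Z X : Finset QVar} {ts : List QType} {q : Tuple Name ts}

theorem contractive_bra (h : Splits Z q X) : Contractive h.bra := by
  intro x
  rw [← tsum_enorm_sq x, ← h.equiv.tsum_eq, ENNReal.tsum_prod
    (f := fun s a => ‖x (h.equiv (s, a))‖ₑ ^ 2), ENNReal.tsum_comm]
  exact ENNReal.tsum_le_tsum fun a => (tsum_enorm_sq (h.bra a x)).ge

theorem isInstr_reset (h : Splits Z q X) : IsInstr (fun _ : Unit => h.reset) h.reset :=
  (IsInstr.kraus ((contractive_rankOne (TupVal.zero ts)).ampl h.equiv)).total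

theorem isInstr_ptrace (h : Splits Z q X) : IsInstr (fun _ : Unit => h.ptrace) h.ptrace :=
  (IsInstr.kraus h.contractive_bra).total

theorem isInstr_measure (h : Splits Z q X) (M : Measurement (TupVal ts)) :
    IsInstr (fun m => sandwich (h.lift (M.op m))) (fun ρ => ∑' m, sandwich (h.lift (M.op m)) ρ) :=
  IsInstr.kraus (M.contractive.ampl h.equiv)

theorem isInstr_unitary (h : Splits Z q X) (U : unitary (EllOp (TupVal ts))) :
    IsInstr (fun _ : Unit => sandwich (h.lift U)) (sandwich (h.lift U)) := by
  refine IsInstr.single fun x => (amplLin_bound h.equiv U.1 x).trans ?_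
  refine mul_le_of_le_one_left (norm_nonneg _) ?_
  -- A unitary has norm one only in a nontrivial algebra; in a trivial one its norm is zero.
  rcases subsingleton_or_nontrivial (EllOp (TupVal ts)) with _ | _
  · rw [Subsingleton.elim U.1 0, norm_zero]
    exact zero_le_one
  · exact (CStarRing.norm_of_mem_unitary U.2).le

theorem isInstr_alloc (h : Splits Z q X) : IsInstr (fun _ : Unit => h.alloc) h.alloc := by
  refine IsInstr.single fun x => ?_
  refine (ContinuousLinearMap.le_of_opNorm_le (c := 1) _ ?_ x).trans (one_mul _).le
  rw [LinearIsometryEquiv.norm_map]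
  exact ContinuousLinearMap.opNorm_le_bound _ zero_le_one (comapLin_bound _ fun _ _ e =>
    (Prod.mk.inj (h.equiv.injective e)).1)

end Splits


/-! ### Terminating branches of a statement -/

/-- A terminating computation: its labels, and the map that it applies to the state. -/
abbrev Branch (X : Finset QVar) : Type := List Label × (Op X → Op X)

/-- The terminating computations of `S[f]` started with variables `X`, given those of procedure
calls. Local variables are always instantiated by `freshTuple`. -/
def Stmt.branches {P : Signature}
    (c : ∀ i, Tuple Name (P.params i) → ∀ X : Finset QVar, Set (Branch X)) :
    {V : Scope} → Stmt P V → Renaming V Name → ∀ X : Finset QVar, Set (Branch X)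
  | _, .bottom, _ => fun _ => {([.eps], fun _ => 0)}
  | _, .skip, _ => fun _ => {([.eps], fun ρ => ρ)}
  | _, .init q, f => fun X => {e | ∃ h : Splits (X \ (Tuple.single (V := Name) (f _ q)).vars)
        (Tuple.single (V := Name) (f _ q)) X, e = ([.eps], h.reset)}
  | _, .unit q U, f => fun X => {e | ∃ h : Splits (X \ Tuple.vars fun i => f _ (q i))
        (fun i => f _ (q i)) X, e = ([.eps], sandwich (h.lift U))}
  | _, .seq S₁ S₂, f => fun X => {e | ∃ a ∈ S₁.branches c f X, ∃ b ∈ S₂.branches c f X,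
        e = (a.1 ++ b.1, fun ρ => b.2 (a.2 ρ))}
  | _, .cond q M S, f => fun X => {e | ∃ h : Splits (X \ Tuple.vars fun i => f _ (q i))
        (fun i => f _ (q i)) X, ∃ m, ∃ a ∈ (S m).branches c f X,
        e = (.out m :: a.1, fun ρ => a.2 (sandwich (h.lift (M.op m)) ρ))}
  | _, .loc ts S, f => fun X =>
      {e | ∃ a ∈ S.branches c (f.bind (freshTuple X ts)) (X ∪ (freshTuple X ts).vars),
        e = (.eps :: (a.1 ++ [.eps]), fun ρ => (splits_freshTuple X ts).ptrace
          (a.2 ((splits_freshTuple X ts).alloc ρ)))}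
  | _, .call i p, f => c i (fun k => f _ (p k))

/-- The terminating computations of procedure calls with recursion depth at most `k`. -/
def Decl.callBranches {P : Signature} (D : Decl P) :
    ℕ → ∀ i, Tuple Name (P.params i) → ∀ X : Finset QVar, Set (Branch X)
  | 0, _, _ => fun _ => ∅
  | k + 1, i, p => fun X => {e | ∃ a ∈ (D.body i).branches (D.callBranches k)
      (Renaming.bind (fun _ v => v) p) X, e = (.eps :: a.1, a.2)}

/-- All terminating computations of procedure calls. -/
def Decl.allCallBranches {P : Signature} (D : Decl P) (i : Fin P.procs)
    (p : Tuple Name (P.params i)) (X : Finset QVar) : Set (Branch X) :=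
  ⋃ k, D.callBranches k i p X

variable {P : Signature}

/-! ### Substitution and unrolling -/

theorem Renaming.bind_under {V W W' : Scope} (f : Renaming V W) (g : Renaming W W')
    {ts : List QType} (r : Tuple W' ts) :
    (fun t v => g.bind r t (f.under ts t v)) = Renaming.bind (fun t v => g t (f t v)) r := by
  funext t v
  cases v <;> rfl

theorem Renaming.comp_bind {V W W' : Scope} (f : Renaming V W) (g : Renaming W W')
    {ts : List QType} (r : Tuple W ts) :
    (fun t v => g t (f.bind r t v)) =
      Renaming.bind (fun t v => g t (f t v)) (fun i => g _ (r i)) := by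
  funext t v
  rcases v with v | ⟨i, rfl⟩ <;> rfl

theorem Stmt.denWith_rename (κ : ∀ i, Tuple Name (P.params i) → Den) {V : Scope} (S : Stmt P V) :
    ∀ {W : Scope} (f : Renaming V W) (g : Renaming W Name),
      (S.rename f).denWith κ g = S.denWith κ (fun t v => g t (f t v)) := by
  induction S with
  | bottom | skip | init | unit | call => intros; rfl
  | seq S₁ S₂ h₁ h₂ => intro W f g; simp only [rename, denWith, h₁, h₂]
  | cond q M S h => intro W f g; simp only [rename, denWith, h]
  | loc ts S h => intro W f g; simp only [rename, denWith, h, Renaming.bind_under]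

theorem Stmt.branches_rename
    (c : ∀ i, Tuple Name (P.params i) → ∀ X : Finset QVar, Set (Branch X))
    {V : Scope} (S : Stmt P V) : ∀ {W : Scope} (f : Renaming V W) (g : Renaming W Name),
      (S.rename f).branches c g = S.branches c (fun t v => g t (f t v)) := by
  induction S with
  | bottom | skip | init | unit | call => intros; rfl
  | seq S₁ S₂ h₁ h₂ => intro W f g; simp only [rename, branches, h₁, h₂]
  | cond q M S h => intro W f g; simp only [rename, branches, h]
  | loc ts S h => intro W f g; simp only [rename, branches, h, Renaming.bind_under]

/-- Replacing calls syntactically amounts to interpreting them by the denotations of the inserted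
bodies; the inserted `skip` denotes the identity. The hypothesis on `f` and `g` ensures that a
global variable of an inserted body still denotes itself below any number of binders. -/
theorem Stmt.denWith_unroll (κ : ∀ i, Tuple Name (Signature.empty.params i) → Den)
    (B : ∀ j, Stmt Signature.empty (Name.extend (P.params j))) {V : Scope} (S : Stmt P V) :
    ∀ (g : Renaming Name V) (f : Renaming V Name), (∀ t v, f t (g t v) = v) →
      (S.unroll B g).denWith κ f =
        S.denWith (fun j p => ((B j).subst p).denWith κ (fun _ v => v)) f := by
  induction S with
  | bottom | skip | init | unit => intros; rfl
  | seq S₁ S₂ h₁ h₂ => intro g f hf; simp only [unroll, denWith, h₁ g f hf, h₂ g f hf]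
  | cond q M S h => intro g f hf; simp only [unroll, denWith, h _ g f hf]
  | loc ts S h =>
    intro g f hf
    funext X ρ
    exact congrArg (fun Θ : Den => (splits_freshTuple X ts).ptrace
      (Θ _ ((splits_freshTuple X ts).alloc ρ)))
      (h (fun t v => .inl (g t v)) (f.bind (freshTuple X ts)) hf)
  | call j p =>
    intro g f hf
    simp only [unroll, denWith, subst, denWith_rename, Renaming.comp_bind, hf]

/-- The denotations of the syntactic approximations of a call. -/
def Decl.approxDen (D : Decl P) (k : ℕ) (i : Fin P.procs) (p : Tuple Name (P.params i)) : Den :=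
  ((D.approx k i).subst p).den₀

theorem Decl.approxDen_succ (D : Decl P) (k : ℕ) (i : Fin P.procs)
    (p : Tuple Name (P.params i)) :
    D.approxDen (k + 1) i p =
      (D.body i).denWith (D.approxDen k) (Renaming.bind (fun _ v => v) p) := by
  refine (Stmt.denWith_rename _ _ _ _).trans ?_
  exact Stmt.denWith_unroll _ (D.approx k) (D.body i) (fun _ v => .inl v) _ fun _ _ => rfl

/-! ### Branches form instruments -/

/-- The branches in `A` have prefix-free labels and form an instrument with sum `Ψ`. -/
structure Resolves {X : Finset QVar} (A : Set (Branch X)) (Ψ : Op X → Op X) : Prop where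
  prefix_free : ∀ a ∈ A, ∀ b ∈ A, a.1 <+: b.1 → a = b
  instr : IsInstr (fun a : A => a.1.2) Ψ

/-- Instruments are constructed over convenient index types. Since no label word is a prefix of one
with another index, indices correspond bijectively to branches and the sum can be reindexed. -/
theorem Resolves.of_family {X : Finset QVar} {A : Set (Branch X)} {Ψ : Op X → Op X} {I : Type}
    {l : I → List Label} {Φ : I → Op X → Op X} (hA : ∀ e, e ∈ A ↔ ∃ i, e = (l i, Φ i))
    (hl : ∀ i j, l i <+: l j → i = j) (h : IsInstr Φ Ψ) : Resolves A Ψ := by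
  constructor
  · intro a ha b hb hab
    obtain ⟨i, rfl⟩ := (hA a).1 ha
    obtain ⟨j, rfl⟩ := (hA b).1 hb
    rw [hl i j hab]
  · let g : I → A := fun i => ⟨(l i, Φ i), (hA _).2 ⟨i, rfl⟩⟩
    have hg : Function.Bijective g := by
      constructor
      · intro i j hij
        have : l i = l j := congrArg (fun a : A => a.1.1) hij
        exact hl i j (this ▸ List.prefix_rfl)
      · rintro ⟨a, ha⟩
        obtain ⟨i, rfl⟩ := (hA a).1 ha
        exact ⟨i, rfl⟩
    refine h.reindex (Equiv.ofBijective g hg).symm fun a => ?_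
    obtain ⟨i, rfl⟩ := hg.2 a
    rw [show g i = Equiv.ofBijective g hg i from rfl, Equiv.symm_apply_apply]
    rfl

theorem Resolves.single {X : Finset QVar} {l : List Label} {Φ : Op X → Op X}
    (h : IsInstr (fun _ : Unit => Φ) Φ) : Resolves {(l, Φ)} Φ :=
  Resolves.of_family (I := Unit) (l := fun _ => l) (by simp) (fun _ _ _ => rfl) h

theorem Resolves.zero_of_empty {X : Finset QVar} {A : Set (Branch X)} (h : ∀ e, e ∉ A) :
    Resolves A (fun _ => 0) :=
  Resolves.of_family (I := Empty) (l := fun i => i.elim) (Φ := fun i => i.elim) (by simp [h])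
    (fun i => i.elim) .empty

/-- Matches the conditional in `Stmt.denWith`: a failing side condition leaves no branch and denotes
`0`. -/
theorem Resolves.guard {X : Finset QVar} {p : Prop} {A : p → Set (Branch X)}
    {Ψ : p → Op X → Op X} (h : ∀ hp, Resolves (A hp) (Ψ hp)) :
    Resolves {e | ∃ hp, e ∈ A hp} (fun ρ => if hp : p then Ψ hp ρ else 0) := by
  by_cases hp : p
  · simpa [hp] using h hp
  · simpa [hp] using Resolves.zero_of_empty (X := X) (A := ∅) (by simp)

theorem Resolves.seq {X : Finset QVar} {A B : Set (Branch X)} {Ψ Ψ' : Op X → Op X}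
    (hA : Resolves A Ψ) (hB : Resolves B Ψ') :
    Resolves {e | ∃ a ∈ A, ∃ b ∈ B, e = (a.1 ++ b.1, fun ρ => b.2 (a.2 ρ))}
      (fun ρ => Ψ' (Ψ ρ)) := by
  refine Resolves.of_family (I := A × B) (l := fun p => p.1.1.1 ++ p.2.1.1) ?_ ?_
    (hA.instr.seq hB.instr)
  · intro e
    simp
  · rintro ⟨⟨a, ha⟩, ⟨b, hb⟩⟩ ⟨⟨a', ha'⟩, ⟨b', hb'⟩⟩ h
    dsimp only at h
    -- `a.1` and `a'.1` are prefixes of one word, so one is a prefix of the other and they belong to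
    -- the same branch. Cancelling them leaves a prefix relation between `b.1` and `b'.1`.
    have h1 : a = a' := by
      rcases List.prefix_or_prefix_of_prefix ((List.prefix_append a.1 b.1).trans h)
        (List.prefix_append a'.1 b'.1) with h1 | h1
      · exact hA.prefix_free _ ha _ ha' h1
      · exact (hA.prefix_free _ ha' _ ha h1).symm
    subst h1
    obtain rfl := hB.prefix_free _ hb _ hb' ((List.prefix_append_right_inj _).1 h)
    rfl

theorem Resolves.cond {X Z : Finset QVar} {ts : List QType} {q : Tuple Name ts} (h : Splits Z q X)
    (M : Measurement (TupVal ts)) {A : M.outcomes → Set (Branch X)}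
    {Ψ : M.outcomes → Op X → Op X} (hA : ∀ m, Resolves (A m) (Ψ m)) :
    Resolves {e | ∃ m, ∃ a ∈ A m,
        e = (.out m :: a.1, fun ρ => a.2 (sandwich (h.lift (M.op m)) ρ))}
      (fun ρ => ∑' m, Ψ m (sandwich (h.lift (M.op m)) ρ)) := by
  refine Resolves.of_family (I := (m : M.outcomes) × A m) (l := fun p => .out p.1 :: p.2.1.1) ?_ ?_
    ((h.isInstr_measure M).sigma fun m => (hA m).instr)
  · intro e
    simp
  · rintro ⟨m, a, ha⟩ ⟨m', a', ha'⟩ h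
    obtain ⟨h1, h2⟩ := List.cons_prefix_cons.1 h
    obtain rfl : m = m' := Subtype.ext (Label.out.inj h1)
    obtain rfl := (hA m).prefix_free _ ha _ ha' h2
    rfl

theorem Resolves.loc {X Y : Finset QVar} {ts : List QType} {r : Tuple Name ts} (h : Splits X r Y)
    {A : Set (Branch Y)} {Ψ : Op Y → Op Y} (hA : Resolves A Ψ) :
    Resolves {e | ∃ a ∈ A, e = (.eps :: (a.1 ++ [.eps]), fun ρ => h.ptrace (a.2 (h.alloc ρ)))}
      (fun ρ => h.ptrace (Ψ (h.alloc ρ))) := by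
  refine Resolves.of_family (I := Unit × A × Unit)
    (l := fun p => .eps :: (p.2.1.1.1 ++ [.eps])) ?_ ?_
    (h.isInstr_alloc.seq (hA.instr.seq h.isInstr_ptrace))
  · intro e
    simp
  · rintro ⟨_, ⟨a, ha⟩, _⟩ ⟨_, ⟨b, hb⟩, _⟩ h
    obtain ⟨-, h2⟩ := List.cons_prefix_cons.1 h
    dsimp only at h2
    suffices hab : a = b by subst hab; rfl
    -- The trailing label of the release is discarded by comparing `a.1` and `b.1` as prefixes of a
    -- common word.
    rcases List.prefix_or_prefix_of_prefix ((List.prefix_append a.1 [.eps]).trans h2)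
      (List.prefix_append b.1 [.eps]) with h1 | h1
    · exact hA.prefix_free _ ha _ hb h1
    · exact (hA.prefix_free _ hb _ ha h1).symm

theorem Resolves.eps_cons {X : Finset QVar} {A : Set (Branch X)} {Ψ : Op X → Op X}
    (hA : Resolves A Ψ) : Resolves {e | ∃ a ∈ A, e = (.eps :: a.1, a.2)} Ψ := by
  refine Resolves.of_family (I := A) (l := fun a => .eps :: a.1.1) ?_ ?_ hA.instr
  · intro e
    simp
  · rintro ⟨a, ha⟩ ⟨b, hb⟩ h
    exact Subtype.ext (hA.prefix_free _ ha _ hb (List.cons_prefix_cons.1 h).2)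

/-- The interpretation of calls is left arbitrary, so that one structural induction serves both the
approximations of bounded depth and their limit. -/
theorem Stmt.resolves {c : ∀ i, Tuple Name (P.params i) → ∀ X : Finset QVar, Set (Branch X)}
    {κ : ∀ i, Tuple Name (P.params i) → Den} (h : ∀ i p X, Resolves (c i p X) (κ i p X))
    {V : Scope} (S : Stmt P V) :
    ∀ (f : Renaming V Name) (X : Finset QVar), Resolves (S.branches c f X) (S.denWith κ f X) := by
  induction S with
  | bottom => exact fun f X => .single .zero
  | skip => exact fun f X => .single .id
  | init q => exact fun f X => .guard fun hp => .single hp.isInstr_reset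
  | unit q U => exact fun f X => .guard fun hp => .single (hp.isInstr_unitary U)
  | seq S₁ S₂ h₁ h₂ => exact fun f X => (h₁ f X).seq (h₂ f X)
  | cond q M S hS => exact fun f X => .guard fun hp => .cond hp M fun m => hS m f X
  | loc ts S hS => exact fun f X => .loc _ (hS _ _)
  | call i p => exact fun f X => h i _ X

/-- Depth zero has no branches, and the empty sum is the denotation of `bottom`. Using the branch
`([.eps], 0)` of `bottom` there would give the same sum but destroy monotonicity in the depth. -/
theorem Decl.resolves_callBranches (D : Decl P) (k : ℕ) :
    ∀ i p X, Resolves (D.callBranches k i p X) (D.approxDen k i p X) := by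
  induction k with
  | zero => exact fun i p X => .zero_of_empty fun _ => id
  | succ k ih =>
    intro i p X
    rw [approxDen_succ]
    exact ((D.body i).resolves ih _ X).eps_cons

theorem Stmt.branches_mono
    {c c' : ∀ i, Tuple Name (P.params i) → ∀ X : Finset QVar, Set (Branch X)}
    (h : ∀ i p X, c i p X ⊆ c' i p X) {V : Scope} (S : Stmt P V) :
    ∀ (f : Renaming V Name) (X : Finset QVar), S.branches c f X ⊆ S.branches c' f X := by
  induction S with
  | bottom | skip | init | unit => exact fun f X => subset_rfl
  | seq S₁ S₂ h₁ h₂ =>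
    rintro f X _ ⟨a, ha, b, hb, rfl⟩
    exact ⟨a, h₁ f X ha, b, h₂ f X hb, rfl⟩
  | cond q M S hS =>
    rintro f X _ ⟨h, m, a, ha, rfl⟩
    exact ⟨h, m, a, hS m f X ha, rfl⟩
  | loc ts S hS =>
    rintro f X _ ⟨a, ha, rfl⟩
    exact ⟨a, hS _ _ ha, rfl⟩
  | call i p => exact fun f X => h i _ X

theorem Decl.callBranches_mono (D : Decl P) {k l : ℕ} (hkl : k ≤ l) (i : Fin P.procs)
    (p : Tuple Name (P.params i)) (X : Finset QVar) :
    D.callBranches k i p X ⊆ D.callBranches l i p X := by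
  have step : ∀ k i p X, D.callBranches k i p X ⊆ D.callBranches (k + 1) i p X := by
    intro k
    induction k with
    | zero => exact fun i p X => Set.empty_subset _
    | succ k ih =>
      rintro i p X _ ⟨a, ha, rfl⟩
      exact ⟨a, (D.body i).branches_mono ih _ X ha, rfl⟩
  exact monotone_nat_of_le_succ (fun k => step k i p X) hkl

/-! ### Limits of increasing sequences of instruments -/

theorem exists_le_of_finset_iUnion {α : Type*} {A : ℕ → Set α} (hA : Monotone A)
    (F : Finset (⋃ k, A k : Set α)) : ∃ k, ∀ a ∈ F, a.1 ∈ A k := by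
  induction F using Finset.induction_on with
  | empty => exact ⟨0, by simp⟩
  | insert a F _ ih =>
    obtain ⟨k, hk⟩ := ih
    obtain ⟨l, hl⟩ := Set.mem_iUnion.1 a.2
    refine ⟨max k l, fun b hb => ?_⟩
    rcases Finset.mem_insert.1 hb with rfl | hb
    · exact hA (le_max_right k l) hl
    · exact hA (le_max_left k l) (hk b hb)

section Limit

variable {X : Finset QVar} {A : ℕ → Set (Branch X)} {Ψ : ℕ → Op X → Op X}

/-- Restriction of a finite subset of a union to a member containing it. -/
theorem exists_finset_of_iUnion (hA : Monotone A) (F : Finset (⋃ k, A k : Set (Branch X))) :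
    ∃ k, ∃ G : Finset (A k), ∀ {M : Type} [AddCommMonoid M] (v : Branch X → M),
      ∑ a ∈ F, v a.1 = ∑ a ∈ G, v a.1 := by
  obtain ⟨k, hk⟩ := exists_le_of_finset_iUnion hA F
  refine ⟨k, F.attach.image fun a => ⟨a.1.1, hk a.1 a.2⟩, fun v => ?_⟩
  rw [Finset.sum_image, ← Finset.sum_attach F]
  rintro ⟨⟨a, ha⟩, ha'⟩ - ⟨⟨b, hb⟩, hb'⟩ - hab
  simpa using hab

theorem resolves_trace_le (hA : Monotone A) (h : ∀ k, Resolves (A k) (Ψ k)) {ρ : Op X}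
    (hρ : IsPTC ρ) : ∑' a : (⋃ k, A k : Set (Branch X)), otr (a.1.2 ρ) ≤ otr ρ := by
  rw [ENNReal.tsum_eq_iSup_sum]
  refine iSup_le fun F => ?_
  obtain ⟨k, G, hG⟩ := exists_finset_of_iUnion hA F
  rw [hG fun a => otr (a.2 ρ)]
  exact (ENNReal.sum_le_tsum G).trans ((h k).instr.trace_le ρ hρ)

theorem resolves_nonneg (h : ∀ k, Resolves (A k) (Ψ k)) {ρ : Op X} (hρ : IsPTC ρ)
    (a : (⋃ k, A k : Set (Branch X))) : 0 ≤ a.1.2 ρ := by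
  obtain ⟨k, hk⟩ := Set.mem_iUnion.1 a.2
  exact (h k).instr.nonneg ⟨a.1, hk⟩ ρ hρ

/-- The total is an upper bound because the branches omitted at depth `k` contribute positive terms.
-/
theorem resolves_isLUB (hA : Monotone A) (h : ∀ k, Resolves (A k) (Ψ k)) {ρ : Op X}
    (hρ : IsPTC ρ) :
    ∃ T, HasSum (fun a : (⋃ k, A k : Set (Branch X)) => a.1.2 ρ) T ∧
      IsLUB (Set.range fun k => Ψ k ρ) T := by
  have hs : Summable fun a : (⋃ k, A k : Set (Branch X)) => a.1.2 ρ :=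
    summable_of_otr (resolves_nonneg h hρ) (ne_top_of_le_ne_top hρ.2 (resolves_trace_le hA h hρ))
  refine ⟨_, hs.hasSum, ?_, ?_⟩
  · rintro _ ⟨k, rfl⟩
    exact hasSum_le_inj (Set.inclusion (Set.subset_iUnion A k)) (Set.inclusion_injective _)
      (fun a _ => resolves_nonneg h hρ a) (fun _ => le_rfl) ((h k).instr.hasSum ρ hρ) hs.hasSum
  · intro U hU
    -- Finitely many branches already occur at one depth `k`, so their sum is at most `Ψ k ρ`, which
    -- `U` dominates.
    refine hasSum_le_of_sum_le hs.hasSum fun F => ?_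
    obtain ⟨k, G, hG⟩ := exists_finset_of_iUnion hA F
    rw [hG fun a => a.2 ρ]
    exact (sum_le_hasSum G (fun a _ => (h k).instr.nonneg a ρ hρ)
      ((h k).instr.hasSum ρ hρ)).trans (hU ⟨k, rfl⟩)

theorem lub_eq {B : ℕ → Op X} {T : Op X} (h : IsLUB (Set.range B) T) : lub B = T := by
  have h' : ∃ T, IsLUB (Set.range B) T := ⟨T, h⟩
  rw [lub, dif_pos h']
  exact h'.choose_spec.unique h

theorem resolves_iUnion (hA : Monotone A) (h : ∀ k, Resolves (A k) (Ψ k)) :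
    Resolves (⋃ k, A k) (fun ρ => lub fun k => Ψ k ρ) := by
  refine ⟨?_, fun a ρ hρ => resolves_nonneg h hρ a, fun ρ hρ => resolves_trace_le hA h hρ, ?_, ?_⟩
  · intro a ha b hb hab
    obtain ⟨k, hk⟩ := Set.mem_iUnion.1 ha
    obtain ⟨l, hl⟩ := Set.mem_iUnion.1 hb
    exact (h (max k l)).prefix_free a (hA (le_max_left k l) hk) b (hA (le_max_right k l) hl) hab
  · intro a
    obtain ⟨k, hk⟩ := Set.mem_iUnion.1 a.2
    exact (h k).instr.additive ⟨a.1, hk⟩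
  · intro ρ hρ
    obtain ⟨T, hT, hL⟩ := resolves_isLUB hA h hρ
    rwa [lub_eq hL]

end Limit

theorem Decl.resolves_allCallBranches (D : Decl P) (i : Fin P.procs)
    (p : Tuple Name (P.params i)) (X : Finset QVar) :
    Resolves (D.allCallBranches i p X) (D.denCall i p X) :=
  resolves_iUnion (fun _ _ h => D.callBranches_mono h i p X)
    fun k => D.resolves_callBranches k i p X

theorem Decl.isLUB_denCall (D : Decl P) (i : Fin P.procs) (p : Tuple Name (P.params i))
    {X : Finset QVar} {ρ : Op X} (hρ : IsPTC ρ) :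
    IsLUB (Set.range fun k => D.approxDen k i p X ρ) (D.denCall i p X ρ) := by
  obtain ⟨T, -, hT⟩ := resolves_isLUB (fun _ _ h => D.callBranches_mono h i p X)
    (fun k => D.resolves_callBranches k i p X) hρ
  unfold denCall
  exact (lub_eq hT).symm ▸ hT

/-- Every branch of a statement uses bounded recursion depth. -/
theorem Stmt.exists_branches_callBranches (D : Decl P) {V : Scope} (S : Stmt P V) :
    ∀ (f : Renaming V Name) (X : Finset QVar), ∀ e ∈ S.branches D.allCallBranches f X,
      ∃ k, e ∈ S.branches (D.callBranches k) f X := by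
  induction S with
  | bottom | skip | init | unit => exact fun f X e he => ⟨0, he⟩
  | seq S₁ S₂ h₁ h₂ =>
    rintro f X _ ⟨a, ha, b, hb, rfl⟩
    obtain ⟨k, hk⟩ := h₁ f X a ha
    obtain ⟨l, hl⟩ := h₂ f X b hb
    exact ⟨max k l, a, S₁.branches_mono (D.callBranches_mono (le_max_left k l)) f X hk,
      b, S₂.branches_mono (D.callBranches_mono (le_max_right k l)) f X hl, rfl⟩
  | cond q M S hS =>
    rintro f X _ ⟨h, m, a, ha, rfl⟩
    obtain ⟨k, hk⟩ := hS m f X a ha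
    exact ⟨k, h, m, a, hk, rfl⟩
  | loc ts S hS =>
    rintro f X _ ⟨a, ha, rfl⟩
    obtain ⟨k, hk⟩ := hS _ _ a ha
    exact ⟨k, a, hk, rfl⟩
  | call i p => exact fun f X e he => Set.mem_iUnion.1 he


/-! ### Relabelling the basis -/

theorem sandwich_comp {J K L : Type} (A : Ell2 K →L[ℂ] Ell2 L) (B : Ell2 J →L[ℂ] Ell2 K)
    (ρ : EllOp J) : sandwich A (sandwich B ρ) = sandwich (A ∘L B) ρ := by
  unfold sandwich
  rw [ContinuousLinearMap.adjoint_comp]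
  rfl

theorem adjoint_comap {J K : Type} (e : J ≃ K) :
    ContinuousLinearMap.adjoint (comap e e.injective) = comap e.symm e.symm.injective := by
  symm
  rw [ContinuousLinearMap.eq_adjoint_iff]
  intro x y
  rw [lp.inner_eq_tsum, lp.inner_eq_tsum, ← e.tsum_eq]
  refine tsum_congr fun j => ?_
  rw [comap_apply, comap_apply, e.symm_apply_apply]

theorem comap_comp_symm {J K : Type} (e : J ≃ K) :
    comap e e.injective ∘L comap e.symm e.symm.injective = ContinuousLinearMap.id ℂ _ := by
  ext x j
  change x (e.symm (e j)) = x j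
  rw [e.symm_apply_apply]

theorem comap_symm_comp {J K : Type} (e : J ≃ K) :
    comap e.symm e.symm.injective ∘L comap e e.injective = ContinuousLinearMap.id ℂ _ := by
  ext x j
  change x (e (e.symm j)) = x j
  rw [e.apply_symm_apply]

theorem sandwich_id {J : Type} (ρ : EllOp J) :
    sandwich (ContinuousLinearMap.id ℂ _) ρ = ρ := by
  unfold sandwich
  rw [ContinuousLinearMap.adjoint_id]
  rfl

/-- Conjugation with an operator, as a continuous linear map. -/
def sandwichL {J K : Type} (A : Ell2 J →L[ℂ] Ell2 K) : EllOp J →L[ℂ] EllOp K :=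
  (ContinuousLinearMap.compL ℂ (Ell2 K) (Ell2 J) (Ell2 K) A) ∘L
    ((ContinuousLinearMap.compL ℂ (Ell2 K) (Ell2 J) (Ell2 J)).flip
      (ContinuousLinearMap.adjoint A))

/-- Transport of operators along a bijection of bases. -/
def transport {J K : Type} (e : J ≃ K) : EllOp K ≃L[ℂ] EllOp J :=
  ContinuousLinearEquiv.equivOfInverse (sandwichL (comap e e.injective))
    (sandwichL (comap e.symm e.symm.injective))
    (fun ρ => (sandwich_comp _ _ ρ).trans (by rw [comap_symm_comp, sandwich_id]))
    (fun ρ => (sandwich_comp _ _ ρ).trans (by rw [comap_comp_symm, sandwich_id]))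

theorem transport_apply {J K : Type} (e : J ≃ K) (ρ : EllOp K) :
    transport e ρ = sandwich (comap e e.injective) ρ := rfl

theorem transport_sandwich {J K J' K' : Type} {e : J' ≃ J} {e' : K' ≃ K}
    {A : Ell2 J →L[ℂ] Ell2 K} {A' : Ell2 J' →L[ℂ] Ell2 K'}
    (h : comap e' e'.injective ∘L A = A' ∘L comap e e.injective) (ρ : EllOp J) :
    transport e' (sandwich A ρ) = sandwich A' (transport e ρ) := by
  rw [transport_apply, transport_apply, sandwich_comp, sandwich_comp, h]

/-! ### Renamings of quantum variables -/

/-- The variable that a renaming assigns to a variable. -/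
def Renaming.on (π : Renaming Name Name) (v : QVar) : QVar := ⟨v.1, π v.1 v.2⟩

/-- The renaming `π` maps `X` bijectively onto `X'`. -/
def Relabels (π : Renaming Name Name) (X X' : Finset QVar) : Prop :=
  Set.BijOn π.on (X : Set QVar) (X' : Set QVar)

/-- The bijection of basis labels induced by a renaming. -/
def Relabels.equiv {π : Renaming Name Name} {X X' : Finset QVar} (h : Relabels π X X') :
    Assign X' ≃ Assign X :=
  (Equiv.piCongrLeft (fun v : X' => Val v.1.1) (Set.BijOn.equiv π.on h)).symm

theorem Relabels.equiv_apply {π : Renaming Name Name} {X X' : Finset QVar} (h : Relabels π X X')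
    (s : Assign X') (v : X) : h.equiv s v = s ⟨π.on v.1, h.mapsTo v.2⟩ := rfl

/-- The transport of operators induced by a renaming. -/
def Relabels.op {π : Renaming Name Name} {X X' : Finset QVar} (h : Relabels π X X') :
    Op X ≃L[ℂ] Op X' := transport h.equiv

theorem Relabels.op_congr {π π' : Renaming Name Name} {X X' : Finset QVar} (h : Relabels π X X')
    (h' : Relabels π' X X') (hπ : ∀ v ∈ X, π.on v = π'.on v) : h.op = h'.op := by
  unfold op
  congr 1
  ext s v
  rw [equiv_apply, equiv_apply]
  have key : ∀ (n n' : Name v.1.1) (hn : (⟨v.1.1, n⟩ : QVar) ∈ X') (hn' : (⟨v.1.1, n'⟩ : QVar) ∈ X'),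
      n = n' → s ⟨⟨v.1.1, n⟩, hn⟩ = s ⟨⟨v.1.1, n'⟩, hn'⟩ := by
    rintro n _ _ _ rfl
    rfl
  exact key _ _ _ _ (eq_of_heq (Sigma.mk.inj (hπ v.1 v.2)).2)

/-- The image of a list of variables under a renaming. -/
def Tuple.map {V W : Scope} {ts : List QType} (q : Tuple V ts) (f : Renaming V W) : Tuple W ts :=
  fun i => f _ (q i)

theorem Tuple.single_map {V W : Scope} {t : QType} (q : V t) (f : Renaming V W) :
    (Tuple.single q).map f = Tuple.single (f t q) := by
  funext ⟨i, hi⟩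
  obtain rfl : i = 0 := by simpa using hi
  rfl

theorem Tuple.mem_vars {ts : List QType} (q : Tuple Name ts) (v : QVar) :
    v ∈ q.vars ↔ ∃ i, q.var i = v := by
  simp [vars]

namespace Splits

variable {Z X Z' X' : Finset QVar} {ts : List QType} {q : Tuple Name ts} {π : Renaming Name Name}

theorem var_mem (h : Splits Z q X) (i : Fin ts.length) : q.var i ∈ X :=
  (h.mem_iff _).2 (.inr ⟨i, rfl⟩)

theorem subset (h : Splits Z q X) : Z ⊆ X := fun v hv => (h.mem_iff v).2 (.inl hv)

/-- The remaining variables are determined by `q` and `X`. This reconciles the arbitrary `Z` in the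
transition rules with the set difference used for denotations and branches. -/
theorem eq_sdiff (h : Splits Z q X) : Z = X \ q.vars := by
  ext v
  rw [Finset.mem_sdiff, h.mem_iff, Tuple.mem_vars]
  constructor
  · exact fun hv => ⟨.inl hv, fun ⟨i, hi⟩ => h.fresh i (hi ▸ hv)⟩
  · rintro ⟨hv | hv, h'⟩
    · exact hv
    · exact absurd hv h'

theorem relabel (h : Splits Z q X) (hX : Relabels π X X') :
    Splits (X' \ (q.map π).vars) (q.map π) X' where
  inj := fun i j hij => h.inj (hX.injOn (h.var_mem i) (h.var_mem j) hij)
  fresh := fun i hi => (Finset.mem_sdiff.1 hi).2 ((Tuple.mem_vars _ _).2 ⟨i, rfl⟩)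
  mem_iff := by
    intro v
    rw [Finset.mem_sdiff, Tuple.mem_vars]
    constructor
    · intro hv
      by_cases hq : ∃ i, (q.map π).var i = v
      · exact .inr hq
      · exact .inl ⟨hv, hq⟩
    · rintro (hv | ⟨i, rfl⟩)
      · exact hv.1
      · exact hX.mapsTo (h.var_mem i)

theorem relabels_rest (h : Splits Z q X) (hX : Relabels π X X') (h' : Splits Z' (q.map π) X') :
    Relabels π Z Z' := by
  refine ⟨fun v hv => ?_, hX.injOn.mono h.subset, fun v' hv' => ?_⟩
  · refine ((h'.mem_iff _).1 (hX.mapsTo (h.subset hv))).resolve_right ?_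
    rintro ⟨i, hi⟩
    have := hX.injOn (h.var_mem i) (h.subset hv) hi
    exact h.fresh i (this ▸ hv)
  · obtain ⟨v, hv, rfl⟩ := hX.surjOn (h'.subset hv')
    refine ⟨v, ((h.mem_iff v).1 hv).resolve_right ?_, rfl⟩
    rintro ⟨i, rfl⟩
    exact h'.fresh i hv'

theorem equiv_relabel (h : Splits Z q X) (hX : Relabels π X X') (h' : Splits Z' (q.map π) X')
    (hZ : Relabels π Z Z') (s : Assign Z') (a : TupVal ts) :
    hX.equiv (h'.equiv (s, a)) = h.equiv (hZ.equiv s, a) := by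
  -- The inverse identifications merely restrict assignments, so the square commutes definitionally;
  -- the forward maps involve choice.
  have key : ∀ s' : Assign X', h.equiv.symm (hX.equiv s') =
      (hZ.equiv (h'.equiv.symm s').1, (h'.equiv.symm s').2) := fun s' => rfl
  rw [← h.equiv.symm_apply_eq, key, Equiv.symm_apply_apply]

theorem comap_lift (h : Splits Z q X) (hX : Relabels π X X') (h' : Splits Z' (q.map π) X')
    (T : EllOp (TupVal ts)) :
    comap hX.equiv hX.equiv.injective ∘L h.lift T =
      h'.lift T ∘L comap hX.equiv hX.equiv.injective := by
  have hZ := h.relabels_rest hX h'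
  ext x s'
  obtain ⟨⟨s, a⟩, rfl⟩ := h'.equiv.surjective s'
  change T (slice h.equiv (h.equiv.symm (hX.equiv (h'.equiv (s, a)))).1 x)
      (h.equiv.symm (hX.equiv (h'.equiv (s, a)))).2 =
    T (slice h'.equiv (h'.equiv.symm (h'.equiv (s, a))).1 (comap hX.equiv hX.equiv.injective x))
      (h'.equiv.symm (h'.equiv (s, a))).2
  have hs : slice h.equiv (hZ.equiv s) x =
      slice h'.equiv s (comap hX.equiv hX.equiv.injective x) := by
    ext b
    change x (h.equiv (hZ.equiv s, b)) = x (hX.equiv (h'.equiv (s, b)))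
    rw [h.equiv_relabel hX h' hZ]
  rw [h.equiv_relabel hX h' hZ, Equiv.symm_apply_apply, Equiv.symm_apply_apply, hs]

theorem comap_bra (h : Splits Z q X) (hX : Relabels π X X') (h' : Splits Z' (q.map π) X')
    (hZ : Relabels π Z Z') (a : TupVal ts) :
    comap hZ.equiv hZ.equiv.injective ∘L h.bra a =
      h'.bra a ∘L comap hX.equiv hX.equiv.injective := by
  ext x s
  change x (h.equiv (hZ.equiv s, a)) = x (hX.equiv (h'.equiv (s, a)))
  rw [h.equiv_relabel hX h' hZ]

/-- Obtained from `comap_bra` by taking adjoints; relabellings are unitary, so they can be moved to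
the opposite sides. -/
theorem comap_adjoint_bra (h : Splits Z q X) (hX : Relabels π X X') (h' : Splits Z' (q.map π) X')
    (hZ : Relabels π Z Z') (a : TupVal ts) :
    comap hX.equiv hX.equiv.injective ∘L ContinuousLinearMap.adjoint (h.bra a) =
      ContinuousLinearMap.adjoint (h'.bra a) ∘L comap hZ.equiv hZ.equiv.injective := by
  have h1 := congrArg ContinuousLinearMap.adjoint (h.comap_bra hX h' hZ a)
  rw [ContinuousLinearMap.adjoint_comp, ContinuousLinearMap.adjoint_comp, adjoint_comap,
    adjoint_comap] at h1
  calc _ = comap hX.equiv hX.equiv.injective ∘L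
        (ContinuousLinearMap.adjoint (h.bra a) ∘L comap hZ.equiv.symm hZ.equiv.symm.injective) ∘L
          comap hZ.equiv hZ.equiv.injective := by
        rw [ContinuousLinearMap.comp_assoc, comap_symm_comp, ContinuousLinearMap.comp_id]
    _ = _ := by
        rw [h1, ← ContinuousLinearMap.comp_assoc, ← ContinuousLinearMap.comp_assoc,
          comap_comp_symm, ContinuousLinearMap.id_comp]

variable {q' : Tuple Name ts}

theorem op_lift (h : Splits Z q X) (hX : Relabels π X X') (h' : Splits Z' q' X')
    (hq : q.map π = q') (T : EllOp (TupVal ts)) (ρ : Op X) :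
    hX.op (sandwich (h.lift T) ρ) = sandwich (h'.lift T) (hX.op ρ) := by
  subst hq
  exact transport_sandwich (h.comap_lift hX h' T) ρ

theorem op_reset (h : Splits Z q X) (hX : Relabels π X X') (h' : Splits Z' q' X')
    (hq : q.map π = q') (ρ : Op X) : hX.op (h.reset ρ) = h'.reset (hX.op ρ) := by
  unfold reset
  rw [ContinuousLinearEquiv.map_tsum]
  exact tsum_congr fun a => h.op_lift hX h' hq _ ρ

theorem op_ptrace (h : Splits Z q X) (hX : Relabels π X X') (h' : Splits Z' q' X')
    (hq : q.map π = q') (hZ : Relabels π Z Z') (ρ : Op X) :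
    hZ.op (h.ptrace ρ) = h'.ptrace (hX.op ρ) := by
  subst hq
  unfold ptrace
  rw [ContinuousLinearEquiv.map_tsum]
  exact tsum_congr fun a => transport_sandwich (h.comap_bra hX h' hZ a) ρ

theorem op_alloc (h : Splits Z q X) (hX : Relabels π X X') (h' : Splits Z' q' X')
    (hq : q.map π = q') (hZ : Relabels π Z Z') (ρ : Op Z) :
    hX.op (h.alloc ρ) = h'.alloc (hZ.op ρ) := by
  subst hq
  exact transport_sandwich (h.comap_adjoint_bra hX h' hZ _) ρ

/-- A renaming of the variables extends to fresh variables. -/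
theorem exists_extend {r r' : Tuple Name ts} (h : Splits Z r X)
    (h' : Splits Z' r' X') (hZ : Relabels π Z Z') :
    ∃ π' : Renaming Name Name, (∀ v ∈ Z, π.on v = π'.on v) ∧ r.map π' = r' ∧
      Relabels π' X X' := by
  let π' : Renaming Name Name := fun t n =>
    if hv : ∃ i, r.var i = ⟨t, n⟩ then r' hv.choose else π t n
  have h1 : ∀ v ∈ Z, π.on v = π'.on v := by
    rintro ⟨t, n⟩ hv
    have : ¬ ∃ i, r.var i = ⟨t, n⟩ := fun ⟨i, hi⟩ => h.fresh i (hi ▸ hv)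
    simp only [Renaming.on, π', dif_neg this]
  have h2 : r.map π' = r' := by
    funext i
    have hi : ∃ j, r.var j = ⟨ts.get i, r i⟩ := ⟨i, rfl⟩
    have hc : hi.choose = i := h.inj hi.choose_spec
    -- Names are natural numbers for every type, so entries at different indices can be compared
    -- without a cast.
    have key : ∀ j : Fin ts.length, j = i → (show ℕ from r' j) = r' i := by
      rintro j rfl
      rfl
    have e : r.map π' i = (show ℕ from r' hi.choose) := by
      simp only [Tuple.map, π', dif_pos hi]
    exact e.trans (key _ hc)
  have h3 : ∀ i, π'.on (r.var i) = r'.var i := fun i => by rw [← h2]; rfl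
  refine ⟨π', h1, h2, fun v hv => ?_, fun v hv w hw hvw => ?_, fun v' hv' => ?_⟩
  · rcases (h.mem_iff v).1 hv with hv | ⟨i, rfl⟩
    · rw [← h1 v hv]
      exact h'.subset (hZ.mapsTo hv)
    · rw [h3]
      exact h'.var_mem i
  · rcases (h.mem_iff v).1 hv with hv | ⟨i, rfl⟩ <;> rcases (h.mem_iff w).1 hw with hw | ⟨j, rfl⟩
    · rw [← h1 v hv, ← h1 w hw] at hvw
      exact hZ.injOn hv hw hvw
    · rw [← h1 v hv, h3] at hvw
      exact absurd (hvw ▸ hZ.mapsTo hv) (h'.fresh j)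
    · rw [← h1 w hw, h3] at hvw
      exact absurd (hvw ▸ hZ.mapsTo hw) (h'.fresh i)
    · rw [h3, h3] at hvw
      rw [h'.inj hvw]
  · rcases (h'.mem_iff v').1 hv' with hv' | ⟨i, rfl⟩
    · obtain ⟨v, hv, rfl⟩ := hZ.surjOn hv'
      exact ⟨v, h.subset hv, (h1 v hv).symm⟩
    · exact ⟨r.var i, h.var_mem i, h3 i⟩

end Splits

/-! ### Free variables -/

theorem Stmt.VarsIn.mono {V : Scope} {S : Stmt P V} :
    ∀ {W W' : ∀ t, V t → Prop}, S.VarsIn W → (∀ t v, W t v → W' t v) → S.VarsIn W' := by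
  induction S with
  | bottom | skip => exact fun _ _ => trivial
  | init q => exact fun h h' => h' _ _ h
  | unit q U => exact fun h h' i => h' _ _ (h i)
  | seq S₁ S₂ h₁ h₂ => exact fun h h' => ⟨h₁ h.1 h', h₂ h.2 h'⟩
  | cond q M S hS => exact fun h h' => ⟨fun i => h' _ _ (h.1 i), fun m => hS m (h.2 m) h'⟩
  | loc ts S hS =>
    intro W W' h h'
    refine hS (W' := fun t => Sum.elim (W' t) fun _ => True) h ?_
    rintro t (v | v) hv
    · exact h' t v hv
    · trivial
  | call i p => exact fun h h' i => h' _ _ (h i)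

theorem Stmt.VarsIn.rename {V : Scope} {S : Stmt P V} :
    ∀ {V' : Scope} {f : Renaming V V'} {W : ∀ t, V' t → Prop},
      S.VarsIn (fun t v => W t (f t v)) → (S.rename f).VarsIn W := by
  induction S with
  | bottom | skip => exact fun _ => trivial
  | init q => exact fun h => h
  | unit q U => exact fun h => h
  | seq S₁ S₂ h₁ h₂ => exact fun h => ⟨h₁ h.1, h₂ h.2⟩
  | cond q M S hS => exact fun h => ⟨h.1, fun m => hS m (h.2 m)⟩
  | loc ts S hS =>
    intro V' f W h
    refine hS (Stmt.VarsIn.mono h ?_)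
    rintro t (v | v) hv
    · exact hv
    · trivial
  | call i p => exact fun h => h

/-! ### Invariance of branches under renaming of the variables of the state -/

/-- Branches of calls are invariant under renamings that fix the variables in `G`. -/
def CallInvariant (c : ∀ i, Tuple Name (P.params i) → ∀ X : Finset QVar, Set (Branch X))
    (G : Finset QVar) : Prop :=
  ∀ (π : Renaming Name Name) (X X' : Finset QVar) (h : Relabels π X X'),
    (∀ v ∈ G, v ∈ X ∧ π.on v = v) → ∀ i (p : Tuple Name (P.params i)), (∀ k, p.var k ∈ X) →
      ∀ e ∈ c i p X, ∃ Φ, (e.1, Φ) ∈ c i (p.map π) X' ∧ ∀ ρ, Φ (h.op ρ) = h.op (e.2 ρ)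

/-- Each elementary operation commutes with the relabelling of the basis, and labels do not mention
variable names. `f'` need agree with `π` after `f` only on the free variables of `S`. -/
theorem Stmt.branches_relabel
    {c : ∀ i, Tuple Name (P.params i) → ∀ X : Finset QVar, Set (Branch X)} {G : Finset QVar}
    (hc : CallInvariant c G) {V : Scope} (S : Stmt P V) :
    ∀ (f f' : Renaming V Name) (π : Renaming Name Name) (X X' : Finset QVar)
      (h : Relabels π X X'), (∀ v ∈ G, v ∈ X ∧ π.on v = v) →
      S.VarsIn (fun t v => (⟨t, f t v⟩ : QVar) ∈ X ∧ f' t v = π t (f t v)) →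
      ∀ e ∈ S.branches c f X, ∃ Φ, (e.1, Φ) ∈ S.branches c f' X' ∧
        ∀ ρ, Φ (h.op ρ) = h.op (e.2 ρ) := by
  induction S with
  | bottom =>
    rintro f f' π X X' h hG - _ rfl
    exact ⟨_, rfl, fun ρ => (map_zero h.op).symm⟩
  | skip =>
    rintro f f' π X X' h hG - _ rfl
    exact ⟨_, rfl, fun ρ => rfl⟩
  | init q =>
    rintro f f' π X X' h hG hS _ ⟨hs, rfl⟩
    have hq : (Tuple.single (V := Name) (f _ q)).map π = Tuple.single (f' _ q) := by
      rw [Tuple.single_map, hS.2]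
    have hs' := hs.relabel h
    rw [hq] at hs'
    exact ⟨_, ⟨hs', rfl⟩, fun ρ => (hs.op_reset h hs' hq ρ).symm⟩
  | unit q U =>
    rintro f f' π X X' h hG hS _ ⟨hs, rfl⟩
    have hf : (fun i => f' _ (q i)) = Tuple.map (fun i => f _ (q i)) π := funext fun i => (hS i).2
    have hs' := hs.relabel h
    have hr := hs.op_lift h hs' rfl U
    simp only [Stmt.branches, hf]
    exact ⟨_, ⟨hs', rfl⟩, fun ρ => (hr ρ).symm⟩
  | seq S₁ S₂ h₁ h₂ =>
    rintro f f' π X X' h hG hS _ ⟨a, ha, b, hb, rfl⟩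
    obtain ⟨Φ, hΦ, hΦ'⟩ := h₁ f f' π X X' h hG hS.1 a ha
    obtain ⟨Φ₂, hΦ₂, hΦ₂'⟩ := h₂ f f' π X X' h hG hS.2 b hb
    exact ⟨_, ⟨_, hΦ, _, hΦ₂, rfl⟩, fun ρ => by simp only [hΦ', hΦ₂']⟩
  | cond q M S hS' =>
    rintro f f' π X X' h hG hS _ ⟨hs, m, a, ha, rfl⟩
    have hf : (fun i => f' _ (q i)) = Tuple.map (fun i => f _ (q i)) π := funext fun i => (hS.1 i).2
    have hs' := hs.relabel h
    have hr := hs.op_lift h hs' rfl (M.op m)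
    obtain ⟨Φ, hΦ, hΦ'⟩ := hS' m f f' π X X' h hG (hS.2 m) a ha
    simp only [Stmt.branches, hf]
    exact ⟨_, ⟨hs', m, _, hΦ, rfl⟩, fun ρ => by rw [← hr]; exact hΦ' _⟩
  | loc ts S hS' =>
    rintro f f' π X X' h hG hS _ ⟨a, ha, rfl⟩
    have hX := splits_freshTuple X ts
    have hX' := splits_freshTuple X' ts
    -- The canonical fresh tuples of `X` and `X'` need not correspond under `π`, so `π` is redefined
    -- on the former. It is unchanged on `X`, hence so is the transport there.
    obtain ⟨π', hπ, hr, hY⟩ := hX.exists_extend hX' h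
    have h' : Relabels π' X X' := h.congr hπ
    have hop : h.op = h'.op := h.op_congr h' hπ
    obtain ⟨Φ, hΦ, hΦ'⟩ := hS' (f.bind (freshTuple X ts)) (f'.bind (freshTuple X' ts)) π' _ _ hY
      (fun v hv => ⟨hX.subset (hG v hv).1, by rw [← hπ v (hG v hv).1, (hG v hv).2]⟩)
      (by
        refine Stmt.VarsIn.mono hS ?_
        rintro t (v | ⟨i, rfl⟩) hv
        · refine ⟨hX.subset hv.1, hv.2.trans ?_⟩
          exact eq_of_heq (Sigma.mk.inj (hπ _ hv.1)).2
        · exact ⟨hX.var_mem i, (congrFun hr i).symm⟩) a ha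
    refine ⟨_, ⟨_, hΦ, rfl⟩, fun ρ => ?_⟩
    dsimp only
    rw [hop, hX.op_ptrace hY hX' hr h', ← hΦ', hX.op_alloc hY hX' hr h']
  | call i p =>
    rintro f f' π X X' h hG hS e he
    have hf : (fun k => f' _ (p k)) = Tuple.map (fun k => f _ (p k)) π := funext fun k => (hS k).2
    simp only [Stmt.branches, hf]
    exact hc π X X' h hG i _ (fun k => (hS k).1) e he

/-- The renaming moves the arguments of a call, while a body mentions global variables by name;
therefore `π` has to fix those. -/
theorem Decl.callInvariant_callBranches {D : Decl P} {G : Finset QVar} (hD : D.VarsSubset G)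
    (k : ℕ) : CallInvariant (D.callBranches k) G := by
  induction k with
  | zero => rintro π X X' h hG i p hp e ⟨⟩
  | succ k ih =>
    rintro π X X' h hG i p hp _ ⟨a, ha, rfl⟩
    obtain ⟨Φ, hΦ, hΦ'⟩ := (D.body i).branches_relabel ih (Renaming.bind (fun _ v => v) p)
      (Renaming.bind (fun _ v => v) (p.map π)) π X X' h hG (by
        refine (hD i).mono ?_
        rintro t (v | ⟨j, rfl⟩) hv
        · exact ⟨(hG _ hv).1, (eq_of_heq (Sigma.mk.inj (hG _ hv).2).2).symm⟩
        · exact ⟨hp j, rfl⟩) a ha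
    exact ⟨Φ, ⟨_, hΦ, rfl⟩, hΦ'⟩

theorem Decl.callInvariant_allCallBranches {D : Decl P} {G : Finset QVar} (hD : D.VarsSubset G) :
    CallInvariant D.allCallBranches G := by
  intro π X X' h hG i p hp e he
  obtain ⟨k, hk⟩ := Set.mem_iUnion.1 he
  obtain ⟨Φ, hΦ, hΦ'⟩ := D.callInvariant_callBranches hD k π X X' h hG i p hp e hk
  exact ⟨Φ, Set.mem_iUnion.2 ⟨k, hΦ⟩, hΦ'⟩


/-! ### Executions -/

theorem not_step_done {D : Decl P} {σ : QState} {l : Label} {C : Config P} :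
    ¬ Step D ⟨.done, σ⟩ l C := by
  rintro ⟨⟩

theorem not_exec_done {D : Decl P} {σ : QState} {α : List Label} {C : Config P} :
    ¬ Exec D ⟨.done, σ⟩ α (some C) := by
  rintro (h | ⟨h, -⟩)
  · exact not_step_done h
  · exact not_step_done h

theorem exec_some_iff {D : Decl P} {C C'' : Config P} {α : List Label} :
    Exec D C α (some C'') ↔ ∃ l β C', α = l :: β ∧ Step D C l C' ∧
      ((β = [] ∧ C' = C'') ∨ Exec D C' β (some C'')) := by
  constructor
  · rintro (h | ⟨h, h'⟩)
    · exact ⟨_, _, _, rfl, h, .inl ⟨rfl, rfl⟩⟩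
    · exact ⟨_, _, _, rfl, h, .inr h'⟩
  · rintro ⟨l, β, C', rfl, h, ⟨rfl, rfl⟩ | h'⟩
    · exact .single h
    · exact .cons h h'

theorem exec_of_step_done {D : Decl P} {α : List Label} {σ σ' : QState}
    (h : (α = [] ∧ (⟨.done, σ⟩ : Config P) = ⟨.done, σ'⟩) ∨
      Exec D ⟨.done, σ⟩ α (some ⟨.done, σ'⟩)) : α = [] ∧ σ' = σ := by
  rcases h with ⟨rfl, h⟩ | h
  · exact ⟨rfl, (Config.mk.inj h).2.symm⟩
  · exact absurd h not_exec_done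

theorem Exec.seq {D : Decl P} {R₁ R₂ : Run P} {σ σ' : QState} {α β : List Label} {C : Config P}
    (h₁ : Exec D ⟨R₁, σ⟩ α (some ⟨.done, σ'⟩)) (h₂ : Exec D ⟨R₂, σ'⟩ β (some C)) :
    Exec D ⟨.seq R₁ R₂, σ⟩ (α ++ β) (some C) := by
  induction α generalizing R₁ σ with
  | nil =>
    obtain ⟨_, _, _, h, -⟩ := exec_some_iff.1 h₁
    cases h
  | cons l α ih =>
    obtain ⟨l', α', ⟨R', σ''⟩, hα, hs, h⟩ := exec_some_iff.1 h₁
    obtain ⟨rfl, rfl⟩ := List.cons.inj hα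
    rcases h with ⟨rfl, h⟩ | h
    · obtain ⟨rfl, rfl⟩ := Config.mk.inj h
      exact .cons (.comp₂ hs) h₂
    · refine .cons (.comp₁ hs ?_) (ih h)
      rintro rfl
      exact not_exec_done h

/-- The word splits at the step that turns the first program into `done`. If `R₂` were `done`, the
execution could stop there and leave no nonempty word for `R₂`. -/
theorem Exec.seq_inv {D : Decl P} {R₁ R₂ : Run P} {σ σ' : QState} {α : List Label}
    (hR : R₂ ≠ .done) (h : Exec D ⟨.seq R₁ R₂, σ⟩ α (some ⟨.done, σ'⟩)) :
    ∃ α₁ α₂ σ₁, α = α₁ ++ α₂ ∧ Exec D ⟨R₁, σ⟩ α₁ (some ⟨.done, σ₁⟩) ∧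
      Exec D ⟨R₂, σ₁⟩ α₂ (some ⟨.done, σ'⟩) := by
  induction α generalizing R₁ σ with
  | nil =>
    obtain ⟨_, _, _, h, -⟩ := exec_some_iff.1 h
    cases h
  | cons l α ih =>
    obtain ⟨l', α', C', hα, hs, h⟩ := exec_some_iff.1 h
    obtain ⟨rfl, rfl⟩ := List.cons.inj hα
    cases hs with
    | comp₁ hs _ =>
      rcases h with ⟨_, h⟩ | h
      · cases h
      · obtain ⟨α₁, α₂, σ₁, rfl, h₁, h₂⟩ := ih h
        exact ⟨_ :: α₁, α₂, σ₁, rfl, .cons hs h₁, h₂⟩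
    | comp₂ hs =>
      rcases h with ⟨_, h⟩ | h
      · exact absurd (Config.mk.inj h).1 hR
      · exact ⟨[_], α, _, rfl, .single hs, h⟩

theorem Exec.stmt_seq_iff {D : Decl P} {S₁ S₂ : Stmt P Name} {σ : QState} {α : List Label}
    {C : Config P} : Exec D ⟨.stmt (.seq S₁ S₂), σ⟩ α (some C) ↔
      Exec D ⟨.seq (.stmt S₁) (.stmt S₂), σ⟩ α (some C) := by
  rw [exec_some_iff, exec_some_iff]
  have : ∀ l C', Step D ⟨.stmt (.seq S₁ S₂), σ⟩ l C' ↔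
      Step D ⟨.seq (.stmt S₁) (.stmt S₂), σ⟩ l C' := by
    refine fun l C' => ⟨fun h => ?_, .stmt_seq⟩
    cases h with
    | stmt_seq h => exact h
  simp only [this]

/-! ### Branches are executions -/

theorem Stmt.rename_id {V : Scope} (S : Stmt P V) : S.rename (fun _ v => v) = S := by
  induction S with
  | bottom | skip | init | unit | call => rfl
  | seq S₁ S₂ h₁ h₂ => simp only [rename, h₁, h₂]
  | cond q M S h => simp only [rename, h]
  | @loc V ts S h =>
    have : Renaming.under (fun (t : QType) (v : V t) => v) ts = fun _ v => v := by
      funext t v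
      cases v <;> rfl
    simp only [rename, this, h]

theorem Stmt.rename_rename {V W W' : Scope} (S : Stmt P V) (f : Renaming V W)
    (g : Renaming W W') : (S.rename f).rename g = S.rename (fun t v => g t (f t v)) := by
  induction S generalizing W W' with
  | bottom | skip | init | unit | call => rfl
  | seq S₁ S₂ h₁ h₂ => simp only [rename, h₁, h₂]
  | cond q M S h => simp only [rename, h]
  | loc ts S h =>
    have : (fun t v => g.under ts t (f.under ts t v)) =
        Renaming.under (fun t v => g t (f t v)) ts := by
      funext t v
      cases v <;> rfl
    simp only [rename, h, this]

theorem Stmt.exec_of_branches_aux (D : Decl P)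
    {c : ∀ i, Tuple Name (P.params i) → ∀ X : Finset QVar, Set (Branch X)}
    (hc : ∀ i p X, ∀ e ∈ c i p X, ∀ ρ, Reaches D (.call i p) ⟨X, ρ⟩ e.1 ⟨X, e.2 ρ⟩)
    {V : Scope} (S : Stmt P V) : ∀ (f : Renaming V Name) (X : Finset QVar),
      ∀ e ∈ S.branches c f X, ∀ ρ, Reaches D (S.rename f) ⟨X, ρ⟩ e.1 ⟨X, e.2 ρ⟩ := by
  induction S with
  | bottom =>
    rintro f X _ rfl ρ
    exact .single (Step.bottom ρ)
  | skip =>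
    rintro f X _ rfl ρ
    exact .single (Step.skip ρ)
  | init q =>
    rintro f X _ ⟨h, rfl⟩ ρ
    exact .single (Step.init ρ _ h)
  | unit q U =>
    rintro f X _ ⟨h, rfl⟩ ρ
    exact .single (Step.unit ρ _ U h)
  | seq S₁ S₂ h₁ h₂ =>
    rintro f X _ ⟨a, ha, b, hb, rfl⟩ ρ
    exact Exec.stmt_seq_iff.2 (Exec.seq (h₁ f X a ha ρ) (h₂ f X b hb _))
  | cond q M S hS =>
    rintro f X _ ⟨h, m, a, ha, rfl⟩ ρ
    exact .cons (Step.cond ρ _ M _ h m) (hS m f X a ha _)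
  | loc ts S hS =>
    rintro f X _ ⟨a, ha, rfl⟩ ρ
    have h := splits_freshTuple X ts
    have h1 := hS _ _ a ha (h.alloc ρ)
    refine .cons (Step.loc ρ _ (freshTuple X ts) h) (Exec.seq ?_ (.single (Step.release _ _ h)))
    rw [subst, rename_rename, Renaming.bind_under]
    exact h1
  | call i p => exact fun f X => hc i _ X

/-- Every branch is an execution. -/
theorem Stmt.exec_of_branches (D : Decl P) (k : ℕ) : ∀ {V : Scope} (S : Stmt P V)
    (f : Renaming V Name) (X : Finset QVar), ∀ e ∈ S.branches (D.callBranches k) f X,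
      ∀ ρ, Reaches D (S.rename f) ⟨X, ρ⟩ e.1 ⟨X, e.2 ρ⟩ := by
  induction k with
  | zero =>
    intro V S
    exact S.exec_of_branches_aux D fun i p X e he => he.elim
  | succ k ih =>
    intro V S
    refine S.exec_of_branches_aux D ?_
    rintro i p X _ ⟨a, ha, rfl⟩ ρ
    exact .cons (.call ρ i p) (ih _ _ X a ha ρ)

/-! ### Executions are branches -/

theorem Relabels.op_of_fixed {π : Renaming Name Name} {X : Finset QVar} (h : Relabels π X X)
    (hπ : ∀ v ∈ X, π.on v = v) (ρ : Op X) : h.op ρ = ρ := by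
  have h' : Relabels (fun _ n => n) X X := Set.bijOn_id _
  rw [h.op_congr h' hπ]
  have : h'.equiv = Equiv.refl _ := Equiv.ext fun _ => rfl
  unfold op
  rw [this]
  exact sandwich_id ρ

theorem Decl.VarsSubset.mono {D : Decl P} {X Y : Finset QVar} (h : D.VarsSubset X) (hXY : X ⊆ Y) :
    D.VarsSubset Y := by
  refine fun i => (h i).mono ?_
  rintro t (v | v) hv
  · exact hXY hv
  · trivial

theorem Stmt.VarsSubset.subst {X Y : Finset QVar} (hXY : X ⊆ Y) {ts : List QType}
    {S : Stmt P (Name.extend ts)}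
    (h : S.VarsIn fun t => Sum.elim (fun v => (⟨t, v⟩ : QVar) ∈ X) fun _ => True)
    {r : Tuple Name ts} (hr : ∀ i, r.var i ∈ Y) : (S.subst r).VarsSubset Y := by
  refine Stmt.VarsIn.rename (h.mono ?_)
  rintro t (v | ⟨i, rfl⟩) hv
  · exact hXY hv
  · exact hr i

/-- A single branch of the body uses calls of bounded depth `k`, so entering the body gives depth `k
+ 1`. -/
theorem Decl.mem_allCallBranches {D : Decl P} {i : Fin P.procs} {p : Tuple Name (P.params i)}
    {X : Finset QVar} {e : Branch X}
    (h : e ∈ (D.body i).branches D.allCallBranches (Renaming.bind (fun _ v => v) p) X) :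
    (.eps :: e.1, e.2) ∈ D.allCallBranches i p X := by
  obtain ⟨k, hk⟩ := Stmt.exists_branches_callBranches D _ _ _ e h
  exact Set.mem_iUnion.2 ⟨k + 1, e, hk, rfl⟩

theorem Stmt.branches_subst {c : ∀ i, Tuple Name (P.params i) → ∀ X : Finset QVar, Set (Branch X)}
    {ts : List QType} (S : Stmt P (Name.extend ts)) (r : Tuple Name ts) :
    (S.subst r).branches c (fun _ v => v) = S.branches c (Renaming.bind (fun _ v => v) r) :=
  S.branches_rename c _ _

/-- Every terminating execution is a branch. -/
theorem branches_of_reaches {D : Decl P} (n : ℕ) : ∀ (S : Stmt P Name) (X : Finset QVar)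
    (ρ : Op X) (α : List Label) (σ : QState), α.length < n → D.VarsSubset X → S.VarsSubset X →
      Reaches D S ⟨X, ρ⟩ α σ →
      ∃ Φ, (α, Φ) ∈ S.branches D.allCallBranches (fun _ v => v) X ∧ σ = ⟨X, Φ ρ⟩ := by
  -- The induction is on a bound for the label length, since calls and local blocks continue with
  -- statements that are not substatements.
  induction n with
  | zero => exact fun S X ρ α σ hα => absurd hα (Nat.not_lt_zero _)
  | succ n ih =>
    intro S X ρ α σ hα hD hS h
    cases S with
    | seq S₁ S₂ =>
      obtain ⟨α₁, α₂, σ₁, rfl, h₁, h₂⟩ :=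
        Exec.seq_inv (by rintro ⟨⟩) (Exec.stmt_seq_iff.1 h)
      -- Both parts are nonempty, so each is strictly shorter than the whole word.
      have hl₁ : 0 < α₁.length := by
        obtain ⟨_, _, _, rfl, -⟩ := exec_some_iff.1 h₁
        simp
      have hl₂ : 0 < α₂.length := by
        obtain ⟨_, _, _, rfl, -⟩ := exec_some_iff.1 h₂
        simp
      rw [List.length_append] at hα
      obtain ⟨Φ₁, hΦ₁, rfl⟩ := ih S₁ X ρ α₁ σ₁ (by omega) hD hS.1 h₁
      obtain ⟨Φ₂, hΦ₂, rfl⟩ := ih S₂ X _ α₂ σ (by omega) hD hS.2 h₂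
      exact ⟨_, ⟨_, hΦ₁, _, hΦ₂, rfl⟩, rfl⟩
    | bottom =>
      obtain ⟨l, β, C, rfl, hs, h⟩ := exec_some_iff.1 h
      cases hs
      obtain ⟨rfl, hσ⟩ := exec_of_step_done h
      exact ⟨_, rfl, hσ⟩
    | skip =>
      obtain ⟨l, β, C, rfl, hs, h⟩ := exec_some_iff.1 h
      cases hs
      obtain ⟨rfl, hσ⟩ := exec_of_step_done h
      exact ⟨_, rfl, hσ⟩
    | init q =>
      obtain ⟨l, β, C, rfl, hs, h⟩ := exec_some_iff.1 h
      cases hs with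
      | init _ _ hq =>
        obtain ⟨rfl, hσ⟩ := exec_of_step_done h
        obtain rfl := hq.eq_sdiff
        exact ⟨_, ⟨hq, rfl⟩, hσ⟩
    | unit q U =>
      obtain ⟨l, β, C, rfl, hs, h⟩ := exec_some_iff.1 h
      cases hs with
      | unit _ _ _ hq =>
        obtain ⟨rfl, hσ⟩ := exec_of_step_done h
        obtain rfl := hq.eq_sdiff
        exact ⟨_, ⟨hq, rfl⟩, hσ⟩
    | cond q M S =>
      obtain ⟨l, β, C, rfl, hs, h⟩ := exec_some_iff.1 h
      cases hs with
      | cond _ _ _ _ hq m =>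
        rcases h with ⟨_, h⟩ | h
        · cases h
        · obtain rfl := hq.eq_sdiff
          obtain ⟨Φ, hΦ, rfl⟩ := ih (S m) X _ β σ (by simpa using hα) hD (hS.2 m) h
          exact ⟨_, ⟨hq, m, _, hΦ, rfl⟩, rfl⟩
    | loc ts S =>
      obtain ⟨l, β, C, rfl, hs, h⟩ := exec_some_iff.1 h
      cases hs with
      | @loc _ Y _ _ _ r hr =>
        rcases h with ⟨_, h⟩ | h
        · cases h
        obtain ⟨α₁, α₂, σ₁, rfl, h₁, h₂⟩ := Exec.seq_inv (by rintro ⟨⟩) h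
        obtain ⟨Φ, hΦ, rfl⟩ := ih (S.subst r) Y _ α₁ σ₁
          (by simp only [List.length_cons, List.length_append] at hα; omega)
          (hD.mono hr.subset) (Stmt.VarsSubset.subst hr.subset hS hr.var_mem) h₁
        obtain ⟨l, β, C, rfl, hs, h₂⟩ := exec_some_iff.1 h₂
        cases hs with
        | @release X' _ _ _ _ hr' =>
          obtain ⟨rfl, hσ⟩ := exec_of_step_done h₂
          obtain rfl : X' = X := hr'.eq_sdiff.trans hr.eq_sdiff.symm
          have hid : Relabels (fun _ n => n) X' X' := Set.bijOn_id _
          have hF := splits_freshTuple X' ts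
          -- The renaming carries the locals `r` chosen by the execution to the canonical ones and
          -- fixes `X'`.
          obtain ⟨π, hπ, hπr, hY⟩ := hr.exists_extend hF hid
          have hX : Relabels π X' X' := hid.congr hπ
          have hop := hX.op_of_fixed fun v hv => (hπ v hv).symm
          rw [Stmt.branches_subst] at hΦ
          obtain ⟨Ψ, hΨ, hΨ'⟩ := S.branches_relabel
            (D.callInvariant_allCallBranches hD) _
            (Renaming.bind (fun _ v => v) (freshTuple X' ts)) π Y _ hY
            (fun v hv => ⟨hr.subset hv, (hπ v hv).symm⟩)
            (by
              refine Stmt.VarsIn.mono hS ?_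
              rintro t (v | ⟨i, rfl⟩) hv
              · exact ⟨hr.subset hv, eq_of_heq (Sigma.mk.inj (hπ _ hv)).2⟩
              · exact ⟨hr.var_mem i, (congrFun hπr i).symm⟩) _ hΦ
          refine ⟨_, ⟨_, hΨ, rfl⟩, hσ.trans ?_⟩
          -- Transport along `π` is the identity on operators over `X'`, so it can be inserted
          -- before the allocation and dropped after the partial trace.
          have ha : hF.alloc ρ = hY.op (hr.alloc ρ) := by
            rw [hr.op_alloc hY hF hπr hX, hop]
          dsimp only
          rw [ha, hΨ', ← hr'.op_ptrace hY hF hπr hX, hop]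
    | call i p =>
      obtain ⟨l, β, C, rfl, hs, h⟩ := exec_some_iff.1 h
      cases hs
      rcases h with ⟨_, h⟩ | h
      · cases h
      · obtain ⟨Φ, hΦ, rfl⟩ := ih _ X ρ β σ (by simpa using hα) hD
          (Stmt.VarsSubset.subst subset_rfl (hD i) hS) h
        rw [Stmt.branches_subst] at hΦ
        exact ⟨Φ, Decl.mem_allCallBranches hΦ, rfl⟩

theorem reaches_iff {D : Decl P} {S : Stmt P Name} {X : Finset QVar} (hD : D.VarsSubset X)
    (hS : S.VarsSubset X) (ρ : Op X) (α : List Label) (σ : QState) :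
    Reaches D S ⟨X, ρ⟩ α σ ↔
      ∃ Φ, (α, Φ) ∈ S.branches D.allCallBranches (fun _ v => v) X ∧ σ = ⟨X, Φ ρ⟩ := by
  refine ⟨branches_of_reaches _ S X ρ α σ (Nat.lt_succ_self _) hD hS, ?_⟩
  rintro ⟨Φ, hΦ, rfl⟩
  obtain ⟨k, hk⟩ := S.exists_branches_callBranches D _ X _ hΦ
  have := S.exec_of_branches D k _ X _ hk ρ
  rwa [Stmt.rename_id] at this

end RQP

end

/-! ### Agreement of the two semantics -/

theorem mainTheorem5 (P : RQP.Signature) (D : RQP.Decl P) (X : Finset RQP.QVar)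
    (hD : D.VarsSubset X) (ρ : RQP.Op X) (hρ : RQP.IsPDOP ρ) :
    (∀ (i : Fin P.procs) (a : RQP.Tuple RQP.Name (P.params i)),
      (∀ k, a.var k ∈ X) →
        IsLUB (Set.range fun n => ((D.approx n i).subst a).den₀ X ρ) (D.den (.call i a) X ρ)) ∧
    ∀ S : RQP.Stmt P RQP.Name, S.VarsSubset X →
      (∀ α σ, RQP.Reaches D S ⟨X, ρ⟩ α σ → σ.vars = X) ∧
      (∀ α σ σ', RQP.Reaches D S ⟨X, ρ⟩ α σ → RQP.Reaches D S ⟨X, ρ⟩ α σ' → σ = σ') ∧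
      HasSum
        (fun e : {e : List RQP.Label × RQP.Op X // RQP.Reaches D S ⟨X, ρ⟩ e.1 ⟨X, e.2⟩} => e.1.2)
        (D.den S X ρ) := by
  refine ⟨fun i a _ => D.isLUB_denCall i a hρ.isPTC, fun S hS => ?_⟩
  have hR := RQP.reaches_iff hD hS ρ
  have hB := S.resolves D.resolves_allCallBranches (fun _ v => v) X
  -- Equal words are prefixes of each other, so prefix-freeness contains determinism.
  have hdet : ∀ α Φ Φ', (α, Φ) ∈ S.branches D.allCallBranches (fun _ v => v) X →
      (α, Φ') ∈ S.branches D.allCallBranches (fun _ v => v) X → Φ = Φ' := fun α Φ Φ' h h' =>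
    congrArg Prod.snd (hB.prefix_free _ h _ h' List.prefix_rfl)
  refine ⟨fun α σ h => ?_, fun α σ σ' h h' => ?_, ?_⟩
  · obtain ⟨Φ, -, rfl⟩ := (hR α σ).1 h
    rfl
  · obtain ⟨Φ, hΦ, rfl⟩ := (hR α σ).1 h
    obtain ⟨Φ', hΦ', rfl⟩ := (hR α σ').1 h'
    rw [hdet α Φ Φ' hΦ hΦ']
  -- A branch goes to its label word and its output on `ρ`. Distinct branches have distinct words
  -- and every execution is a branch, so the sum over executions is the instrument's sum reindexed.
  · let g : S.branches D.allCallBranches (fun _ v => v) X →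
        {e : List RQP.Label × RQP.Op X // RQP.Reaches D S ⟨X, ρ⟩ e.1 ⟨X, e.2⟩} :=
      fun a => ⟨(a.1.1, a.1.2 ρ), (hR _ _).2 ⟨a.1.2, a.2, rfl⟩⟩
    have hg : Function.Bijective g := by
      constructor
      · rintro ⟨a, ha⟩ ⟨b, hb⟩ hab
        have h : a.1 = b.1 := congrArg (fun e => e.1.1) hab
        exact Subtype.ext (hB.prefix_free _ ha _ hb (h ▸ List.prefix_rfl))
      · rintro ⟨⟨α, ρ'⟩, h⟩
        obtain ⟨Φ, hΦ, h⟩ := (hR _ _).1 h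
        obtain rfl : ρ' = Φ ρ := eq_of_heq (RQP.QState.mk.inj h).2
        exact ⟨⟨_, hΦ⟩, rfl⟩
    exact ((Equiv.ofBijective g hg).hasSum_iff
      (f := fun e : {e : List RQP.Label × RQP.Op X // RQP.Reaches D S ⟨X, ρ⟩ e.1 ⟨X, e.2⟩} =>
        e.1.2)).1
      (hB.instr.hasSum ρ hρ.isPTC)
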